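/- Let $d\ge 3$ and let $H_\omega=-\Delta+V_\omega$ be the Anderson operator on $\ell^2(\mathbb Z^d)$, $$(H_\omega\psi)(x)=\sum_{|y-x|_1=1}(\psi(x)-\psi(y))+\omega_x\psi(x),$$ where $(\omega_x)_{x\in\mathbb Z^d}$ are i.i.d. with a Borel probability distribution $\mu$ on $\mathbb R$ of bounded support, and let $\mathbb P=\bigotimes_{\mathbb Z^d}\mu$. For real $L>0$ let $\Lambda_L=[-L/2,L/2)^d\cap\mathbb Z^d$, let $H_\omega^{\Lambda_L}$ be the compression of $H_\omega$ to $\ell^2(\Lambda_L)$, and let $$N_\omega^{\Lambda_L}(E)=\frac{\#\{\text{eigenvalues of }H_\omega^{\Lambda_L}\text{ that are}\le E,\text{ counted with multiplicity}\}}{|\Lambda_L|}.$$ Let $N=N_\mu$ be the integrated density of states, $$N(E)=\mathbb E\,\mathrm{Tr}\big[\mathbf 1_{(-\infty,E]}(H_\omega)\mathbf 1_{\Lambda_1}\big]=\mathbb E\,\langle\delta_0,\mathbf 1_{(-\infty,E]}(H_\omega)\delta_0\rangle .$$ Put $$C=40d+104\cdot 2^d-51,\qquad K=\frac{480}{\log(3/2)}+\frac{16}{\log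 2}.$$ Then $K<1207$. Moreover, for all $\alpha,\beta\in(0,1)$ and every real $L$ with $$L>\max\left\{\Big(\frac C\beta+1\Big)^2,\ \Big(\big(K\log(2/\alpha)\big)^{2/(d-2)}+1\Big)^2,\ 16\right\}$$ one has $$\sup_\mu\ \mathbb P\{\|N_\omega^{\Lambda_L}-N\|_\infty>\beta\}<\alpha,$$ where the supremum is over all Borel probability measures $\mu$ on $\mathbb R$ with bounded support. Consequently, for every such $\mu$, with $\mathbb P$-probability greater than $1-\alpha$ the function $N$ lies in the confidence region $$\{\rho:\mathbb R\to\mathbb R \text{ bounded, right-continuous and isotone}:\ \|N_\omega^{\Lambda_L}-\rho\|_\infty\le\beta\}.$$ -/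

import Mathlib

open MeasureTheory Set
open scoped ENNReal Topology

noncomputable section

namespace Anderson

/-- The action of `-Δ + V_ω` on arbitrary functions on `ℤ^d`:
`(H_ω ψ)(x) = ∑_{|y - x|₁ = 1} (ψ x - ψ y) + ω_x ψ x`.
The neighbours of `x` are the `2 d` points `x ± e_i`. -/
def formalOp {d : ℕ} (ω : (Fin d → ℤ) → ℝ) :
    ((Fin d → ℤ) → ℂ) →ₗ[ℂ] ((Fin d → ℤ) → ℂ) where
  toFun ψ x :=
    (∑ i : Fin d, ((ψ x - ψ (x + Pi.single i 1)) + (ψ x - ψ (x - Pi.single i 1)))) + (ω x : ℂ) * ψ x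
  map_add' φ ψ := by
    funext x
    have h : ∀ i : Fin d, (((φ + ψ) x - (φ + ψ) (x + Pi.single i 1)) +
        ((φ + ψ) x - (φ + ψ) (x - Pi.single i 1))) =
        ((φ x - φ (x + Pi.single i 1)) + (φ x - φ (x - Pi.single i 1))) +
        ((ψ x - ψ (x + Pi.single i 1)) + (ψ x - ψ (x - Pi.single i 1))) := by
      intro i; simp only [Pi.add_apply]; ring
    simp only [h]
    rw [Finset.sum_add_distrib]
    simp only [Pi.add_apply]
    ring
  map_smul' c ψ := by
    funext x
    simp only [Pi.smul_apply, smul_eq_mul, RingHom.id_apply, mul_add, Finset.mul_sum, mul_sub]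
    ring_nf

/-- The Hilbert space `ℓ²(ℤ^d)`. -/
abbrev Ell2 (d : ℕ) : Type := lp (fun _ : Fin d → ℤ => ℂ) 2

/-- For a bounded potential, `H_ω` maps `ℓ²(ℤ^d)` to itself. -/
theorem memℓp_formalOp {d : ℕ} {ω : (Fin d → ℤ) → ℝ} (h : ∃ R, ∀ k, |ω k| ≤ R) (ψ : Ell2 d) :
    Memℓp (formalOp ω (ψ : (Fin d → ℤ) → ℂ)) 2 := by
  obtain ⟨R, hR⟩ := h
  have hψ : Memℓp (fun x => (ψ : (Fin d → ℤ) → ℂ) x) 2 := lp.memℓp ψ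
  have hp : 0 < (2 : ℝ≥0∞).toReal := by norm_num
  have hshift : ∀ e : Fin d → ℤ, Memℓp (fun x => (ψ : (Fin d → ℤ) → ℂ) (x + e)) 2 := by
    intro e
    refine memℓp_gen ?_
    exact (hψ.summable hp).comp_injective (add_left_injective e)
  have hsum : Memℓp (fun x => ∑ i : Fin d,
      (((ψ : (Fin d → ℤ) → ℂ) x - (ψ : (Fin d → ℤ) → ℂ) (x + Pi.single i 1)) +
        ((ψ : (Fin d → ℤ) → ℂ) x - (ψ : (Fin d → ℤ) → ℂ) (x - Pi.single i 1)))) 2 := by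
    refine Memℓp.finsetSum Finset.univ (fun i _ => ?_)
    refine (hψ.sub (hshift _)).add (hψ.sub ?_)
    simpa only [sub_eq_add_neg] using hshift (-Pi.single i 1)
  have hmul : Memℓp (fun x => (ω x : ℂ) * (ψ : (Fin d → ℤ) → ℂ) x) 2 := by
    refine memℓp_gen ?_
    have hs := (hψ.summable hp).mul_left (R ^ (2 : ℝ≥0∞).toReal)
    refine Summable.of_nonneg_of_le (fun x => by positivity) (fun x => ?_) hs
    rw [norm_mul, Real.mul_rpow (norm_nonneg _) (norm_nonneg _)]
    have hx : ‖(ω x : ℂ)‖ ≤ R := by simpa using hR x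
    gcongr
  exact hsum.add hmul

/-- The Anderson operator `H_ω = -Δ + V_ω` as a bounded operator on `ℓ²(ℤ^d)`, for a bounded
potential `ω` (it is set to `0` when `ω` is unbounded). -/
def op {d : ℕ} (ω : (Fin d → ℤ) → ℝ) : Ell2 d →L[ℂ] Ell2 d :=
  open scoped Classical in
  if h : ∃ R, ∀ k, |ω k| ≤ R then
    ContinuousLinearMap.ofSeqClosedGraph
      (g := ({ toFun := fun ψ => ⟨formalOp ω ψ, memℓp_formalOp h ψ⟩
               map_add' := fun φ ψ => by ext1; exact map_add (formalOp ω) _ _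
               map_smul' := fun c ψ => by ext1; exact map_smul (formalOp ω) c _ } : Ell2 d →ₗ[ℂ] Ell2 d))
      (by
        intro u x y hu hv
        have hev : ∀ k : Fin d → ℤ, Continuous (fun ψ : Ell2 d => (ψ : (Fin d → ℤ) → ℂ) k) :=
          fun k => (lp.lipschitzWith_one_eval (E := fun _ : Fin d → ℤ => ℂ) 2 k).continuous
        have hc : ∀ k : Fin d → ℤ,
            Continuous (fun ψ : Ell2 d => formalOp ω (ψ : (Fin d → ℤ) → ℂ) k) := by
          intro k
          exact (continuous_finsetSum _ fun i _ =>
            ((hev k).sub (hev _)).add ((hev k).sub (hev _))).add (continuous_const.mul (hev k))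
        ext k
        exact tendsto_nhds_unique (((hev k).tendsto y).comp hv) (((hc k).tendsto x).comp hu))
  else 0

/-- For a bounded potential, `op ω` acts by the defining formula. -/
theorem op_apply {d : ℕ} {ω : (Fin d → ℤ) → ℝ} (h : ∃ R, ∀ k, |ω k| ≤ R) (ψ : Ell2 d)
    (x : Fin d → ℤ) :
    (op ω ψ : (Fin d → ℤ) → ℂ) x = formalOp ω (ψ : (Fin d → ℤ) → ℂ) x := by
  rw [op, dif_pos h]
  rfl

/-- The spectral projection `1_{(-∞, E]}(A)` of a bounded self-adjoint operator `A`: the orthogonal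
projection onto the kernel of the positive part `(A - E)₊` (continuous functional calculus), which
is the spectral subspace of `A` for `(-∞, E]`, because `(t - E)₊ = 0` exactly for `t ≤ E`. -/
def spectralProj {H : Type*} [NormedAddCommGroup H] [InnerProductSpace ℂ H] [CompleteSpace H]
    (A : H →L[ℂ] H) (E : ℝ) : H →L[ℂ] H :=
  haveI : CompleteSpace (LinearMap.ker (cfc (fun t : ℝ => max (t - E) 0) A).toLinearMap) :=
    (cfc (fun t : ℝ => max (t - E) 0) A).isClosed_ker.completeSpace_coe
  (LinearMap.ker (cfc (fun t : ℝ => max (t - E) 0) A).toLinearMap).starProjection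

/-- The lattice points of the box `Λ_L = [-L/2, L/2)^d`. -/
def box (d : ℕ) (L : ℝ) : Finset (Fin d → ℤ) :=
  Fintype.piFinset fun _ => Finset.Ico ⌈-(L / 2)⌉ ⌈L / 2⌉

theorem mem_box {d : ℕ} {L : ℝ} {x : Fin d → ℤ} :
    x ∈ box d L ↔ ∀ i, (x i : ℝ) ∈ Set.Ico (-(L / 2)) (L / 2) := by
  simp [box, Int.ceil_le, Int.lt_ceil]

/-- The law `ℙ = ⨂_{ℤ^d} μ` of the i.i.d. potential. -/
def law (d : ℕ) (μ : ProbabilityMeasure ℝ) : Measure ((Fin d → ℤ) → ℝ) :=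
  Measure.infinitePi fun _ => (μ : Measure ℝ)

/-- The integrated density of states
`N(E) = 𝔼 Tr[1_{(-∞, E]}(H_ω) 1_{Λ_1}] = 𝔼 ∑_{k ∈ Λ_1} ⟨δ_k, 1_{(-∞, E]}(H_ω) δ_k⟩`,
where `Λ_1` is the unit cube (whose only lattice point is `0`). -/
def ids (d : ℕ) (μ : ProbabilityMeasure ℝ) (E : ℝ) : ℝ :=
  ∫ ω, ∑ k ∈ box d 1,
    (inner ℂ (lp.single 2 k (1 : ℂ) : Ell2 d)
      (spectralProj (op ω) E (lp.single 2 k (1 : ℂ) : Ell2 d))).re ∂(law d μ)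

/-- The matrix of the compression `H_ω^Λ = p_Λ H_ω i_Λ` to `ℓ²(Λ)`, with `i_Λ` the extension by
zero and `p_Λ` the restriction to `Λ`. -/
def boxMatrix {d : ℕ} (ω : (Fin d → ℤ) → ℝ) (Λ : Finset (Fin d → ℤ)) : Matrix Λ Λ ℂ :=
  LinearMap.toMatrix' ((LinearMap.funLeft ℂ ℂ (Subtype.val : Λ → (Fin d → ℤ))) ∘ₗ formalOp ω ∘ₗ
    Function.ExtendByZero.linearMap ℂ (Subtype.val : Λ → (Fin d → ℤ)))

theorem boxMatrix_apply {d : ℕ} (ω : (Fin d → ℤ) → ℝ) (Λ : Finset (Fin d → ℤ)) (x y : Λ) :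
    boxMatrix ω Λ x y = formalOp ω (Pi.single y.1 1) x.1 := by
  have h : Function.extend (Subtype.val : Λ → (Fin d → ℤ)) (Pi.single y (1 : ℂ)) 0 =
      Pi.single y.1 1 := by
    funext z
    by_cases hz : z ∈ Λ
    · have := Subtype.val_injective.extend_apply (Pi.single y (1 : ℂ)) 0 (⟨z, hz⟩ : Λ)
      rw [this]
      simp [Pi.single_apply, Subtype.ext_iff]
    · rw [Function.extend_apply' _ _ _ (by rintro ⟨a, rfl⟩; exact hz a.2)]
      have : z ≠ y.1 := by rintro rfl; exact hz y.2
      simp [this]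
  simp only [boxMatrix, LinearMap.toMatrix'_apply, LinearMap.comp_apply, LinearMap.funLeft_apply]
  rw [← h]
  rfl

theorem isHermitian_boxMatrix {d : ℕ} (ω : (Fin d → ℤ) → ℝ) (Λ : Finset (Fin d → ℤ)) :
    (boxMatrix ω Λ).IsHermitian := by
  ext x y
  rw [Matrix.conjTranspose_apply, boxMatrix_apply, boxMatrix_apply]
  have e1 : ∀ i : Fin d, (y.1 + Pi.single i 1 = x.1) ↔ (x.1 - Pi.single i 1 = y.1) := fun i =>
    ⟨fun h => by rw [← h]; abel, fun h => by rw [← h]; abel⟩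
  have e2 : ∀ i : Fin d, (y.1 - Pi.single i 1 = x.1) ↔ (x.1 + Pi.single i 1 = y.1) := fun i =>
    ⟨fun h => by rw [← h]; abel, fun h => by rw [← h]; abel⟩
  have hω : (ω y.1 : ℂ) * (if x.1 = y.1 then 1 else 0) = ω x.1 * (if x.1 = y.1 then 1 else 0) := by
    split_ifs with h
    · rw [h]
    · simp
  have hs : ∀ p : Prop, [Decidable p] → star (if p then (1 : ℂ) else 0) = if p then 1 else 0 := by
    intro p _; split_ifs <;> simp
  have hr : ∀ t : ℝ, star (t : ℂ) = t := fun t => Complex.conj_ofReal t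
  simp only [formalOp, LinearMap.coe_mk, AddHom.coe_mk, Pi.single_apply, e1, e2,
    eq_comm (a := y.1) (b := x.1), star_add, star_sub, star_sum, star_mul', hs, hr, hω]
  congr 1
  exact Finset.sum_congr rfl fun i _ => by ring

/-- The normalized eigenvalue counting function of `H_ω^Λ` (eigenvalues with multiplicity). -/
def countingFun {d : ℕ} (ω : (Fin d → ℤ) → ℝ) (Λ : Finset (Fin d → ℤ)) (E : ℝ) : ℝ :=
  (Finset.univ.filter fun j : Λ => (isHermitian_boxMatrix ω Λ).eigenvalues j ≤ E).card / Λ.card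

/-- The sup-norm of a function on `ℝ`, as an extended nonnegative real. -/
def supNorm (f : ℝ → ℝ) : ℝ≥0∞ := ⨆ E : ℝ, ‖f E‖ₑ

/-- The confidence region of level `β` for the sample `ω` on the box `Λ_L`: all bounded,
right-continuous, isotone functions within distance `β` of the counting function. -/
def confidenceRegion (d : ℕ) (L β : ℝ) (ω : (Fin d → ℤ) → ℝ) : Set (ℝ → ℝ) :=
  {ρ | (∃ B, ∀ E, |ρ E| ≤ B) ∧ (∀ E, ContinuousWithinAt ρ (Set.Ici E) E) ∧ Monotone ρ ∧
    supNorm (fun E => countingFun ω (box d L) E - ρ E) ≤ ENNReal.ofReal β}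

end Anderson

end

/-! Write `x = √L`. The box is a cube of side `ℓ`, with `ℓ` close to `x ^ 2`. Inside it place cells
of side `b`, with `b + 1 = ⌈x⌉`, leaving one empty layer of sites between neighbouring cells. The
gaps decouple the cells: eigenvectors of the cells, extended by zero, are orthonormal and
diagonalize the form of the box matrix. Interlacing (`card_filter_le_card_eigenvalues`, a dimension
count) then shows that passing from the box to its cells changes the number of eigenvalues `≤ E` by
at most the number of uncovered sites, for every `ω` and `E` at once
(`eigCount_bounds_of_separated`, `abs_countingFun_sub_cellAverage_le`). No bound on the potential
enters.

The counting functions of the cells are independent, identically distributed and monotone in `E`,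
with mean `meanCount`. Hoeffding's inequality at each level `k / N` of the mean, together with
monotonicity in `E`, gives a deviation bound uniform in `E` (`measure_exists_deviation_le`).

The mean is within `d / (b + 1)` of the integrated density of states, uniformly in `E`
(`abs_ids_sub_meanCount_le`). The tiling estimate, integrated, compares `meanCount` at side `b` with
`meanCount` at side `ℓ`, and `ℓ → ∞` identifies the limit: traces of powers of the box matrix
converge per site to moments of `H_ω` at `0`, polynomials approximate continuous functions, and
ramps approximate the indicator of `(-∞, E]`. The bound on the support serves only to justify these
limits and does not appear in the rate, so the final estimate is uniform in `μ`.

The three errors add up to `(3 d + 20) / (x - 1) ≤ β`. There are at least `(x - 2) ^ d` cells and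
the deviation allowed is `10 / (x - 1)`, so the bad event has probability at most `exp (-(x - 2) ^
(d - 2))` (`law_deviation_le`), which the hypothesis on `L` makes smaller than `α`. -/

section LinearAlgebra

/-! ### Interlacing by a dimension count -/

variable {V : Type*} [NormedAddCommGroup V] [InnerProductSpace ℂ V]

theorem inner_sum_sum_of_diagonal {ι : Type*} [Fintype ι] [DecidableEq ι] (T : V →ₗ[ℂ] V)
    (v : ι → V) (μ : ι → ℝ)
    (h : ∀ s t, inner ℂ (v s) (T (v t)) = if s = t then (μ s : ℂ) else 0) (c : ι → ℂ) :
    inner ℂ (∑ s, c s • v s) (T (∑ s, c s • v s)) = ((∑ s, ‖c s‖ ^ 2 * μ s : ℝ) : ℂ) := by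
  simp only [map_sum, map_smul, sum_inner, inner_sum, inner_smul_left, inner_smul_right, h]
  simp only [mul_ite, mul_zero, Finset.sum_ite_eq', Finset.mem_univ, if_true]
  push_cast
  refine Finset.sum_congr rfl fun s _ => ?_
  rw [← mul_assoc, Complex.mul_conj, Complex.normSq_eq_norm_sq]
  push_cast
  ring

/-- Two orthonormal families that diagonalize the form of `T`, one with values `≤ E` and one with
values `> E`, are jointly linearly independent. -/
theorem card_add_card_le_finrank_of_diagonal [FiniteDimensional ℂ V] {ι κ : Type*} [Fintype ι]
    [DecidableEq ι] [Fintype κ] [DecidableEq κ] (T : V →ₗ[ℂ] V) (v : ι → V) (u : κ → V)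
    (hv : Orthonormal ℂ v) (hu : Orthonormal ℂ u) (μ : ι → ℝ) (ν : κ → ℝ)
    (hμ : ∀ s t, inner ℂ (v s) (T (v t)) = if s = t then (μ s : ℂ) else 0)
    (hν : ∀ s t, inner ℂ (u s) (T (u t)) = if s = t then (ν s : ℂ) else 0) (E : ℝ)
    (hμE : ∀ s, μ s ≤ E) (hνE : ∀ s, E < ν s) :
    Fintype.card ι + Fintype.card κ ≤ Module.finrank ℂ V := by
  have hli : LinearIndependent ℂ (Sum.elim v u) := by
    rw [Fintype.linearIndependent_iff]
    intro g hg
    simp only [Fintype.sum_sum_type, Sum.elim_inl, Sum.elim_inr] at hg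
    set w := ∑ s, g (Sum.inl s) • v s with hw
    set z := ∑ s, g (Sum.inr s) • u s with hz
    have hwz : w = -z := eq_neg_of_add_eq_zero_left hg
    -- A linear relation makes `w` and `-z` the same vector, with form at most `E` times its squared
    -- norm by the first family, and strictly more by the second unless all coefficients of `z`
    -- vanish.
    have hform : inner ℂ w (T w) = inner ℂ z (T z) := by
      rw [hwz, map_neg, inner_neg_neg]
    have hnorm : inner ℂ w w = inner ℂ z z := by
      rw [hwz, inner_neg_neg]
    have hvv : ∀ s t, inner ℂ (v s) ((LinearMap.id : V →ₗ[ℂ] V) (v t)) =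
        if s = t then ((1 : ℝ) : ℂ) else 0 := by
      intro s t
      simpa using orthonormal_iff_ite.1 hv s t
    have huu : ∀ s t, inner ℂ (u s) ((LinearMap.id : V →ₗ[ℂ] V) (u t)) =
        if s = t then ((1 : ℝ) : ℂ) else 0 := by
      intro s t
      simpa using orthonormal_iff_ite.1 hu s t
    have n1 := inner_sum_sum_of_diagonal LinearMap.id v (fun _ => 1) hvv (fun s => g (Sum.inl s))
    have n2 := inner_sum_sum_of_diagonal LinearMap.id u (fun _ => 1) huu (fun s => g (Sum.inr s))
    have f1 := inner_sum_sum_of_diagonal T v μ hμ (fun s => g (Sum.inl s))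
    have f2 := inner_sum_sum_of_diagonal T u ν hν (fun s => g (Sum.inr s))
    simp only [LinearMap.id_apply, mul_one] at n1 n2
    rw [← hw] at n1 f1
    rw [← hz] at n2 f2
    have e1 : (∑ s, ‖g (Sum.inl s)‖ ^ 2 : ℝ) = ∑ s, ‖g (Sum.inr s)‖ ^ 2 := by
      have := n1.symm.trans (hnorm.trans n2)
      exact_mod_cast this
    have e2 : (∑ s, ‖g (Sum.inl s)‖ ^ 2 * μ s : ℝ) = ∑ s, ‖g (Sum.inr s)‖ ^ 2 * ν s := by
      have := f1.symm.trans (hform.trans f2)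
      exact_mod_cast this
    have e3 : (∑ s, ‖g (Sum.inl s)‖ ^ 2 * μ s : ℝ) ≤ (∑ s, ‖g (Sum.inl s)‖ ^ 2) * E := by
      rw [Finset.sum_mul]
      exact Finset.sum_le_sum fun s _ => mul_le_mul_of_nonneg_left (hμE s) (by positivity)
    have e4 : ∑ s, ‖g (Sum.inr s)‖ ^ 2 * (ν s - E) ≤ 0 := by
      simp only [mul_sub, Finset.sum_sub_distrib, ← Finset.sum_mul]
      rw [← e2, ← e1]
      linarith
    have e5 : ∀ s, 0 ≤ ‖g (Sum.inr s)‖ ^ 2 * (ν s - E) := fun s =>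
      mul_nonneg (by positivity) (sub_nonneg.2 (hνE s).le)
    have e6 := (Finset.sum_eq_zero_iff_of_nonneg fun s _ => e5 s).1
      (le_antisymm e4 (Finset.sum_nonneg fun s _ => e5 s))
    have hr : ∀ s, g (Sum.inr s) = 0 := by
      intro s
      have := e6 s (Finset.mem_univ s)
      have h' : ν s - E ≠ 0 := (sub_pos.2 (hνE s)).ne'
      simpa [h'] using this
    have hl : ∀ s, g (Sum.inl s) = 0 := by
      have h0 : (∑ s, ‖g (Sum.inl s)‖ ^ 2 : ℝ) = 0 := by rw [e1]; simp [hr]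
      have := (Finset.sum_eq_zero_iff_of_nonneg fun s _ => by positivity).1 h0
      intro s
      simpa using this s (Finset.mem_univ s)
    rintro (s | s)
    · exact hl s
    · exact hr s
  simpa using hli.fintype_card_le_finrank

/-- Interlacing: compressing a Hermitian form to the span of an orthonormal family that
diagonalizes it decreases both the number of eigenvalues `≤ E` and the number of those `> E`. -/
theorem card_filter_le_card_eigenvalues {n : Type*} [Fintype n] [DecidableEq n]
    {A : Matrix n n ℂ} (hA : A.IsHermitian) {ι : Type*} [Fintype ι] [DecidableEq ι]
    (v : ι → EuclideanSpace ℂ n) (hv : Orthonormal ℂ v) (μ : ι → ℝ)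
    (hμ : ∀ s t, inner ℂ (v s) (Matrix.toEuclideanLin A (v t)) = if s = t then (μ s : ℂ) else 0)
    (E : ℝ) :
    (Finset.univ.filter fun s => μ s ≤ E).card ≤
        (Finset.univ.filter fun i => hA.eigenvalues i ≤ E).card ∧
      (Finset.univ.filter fun s => E < μ s).card ≤
        (Finset.univ.filter fun i => E < hA.eigenvalues i).card := by
  have hν : ∀ i j, inner ℂ (hA.eigenvectorBasis i)
      (Matrix.toEuclideanLin A (hA.eigenvectorBasis j)) =
      if i = j then (hA.eigenvalues i : ℂ) else 0 := by
    intro i j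
    have h1 : Matrix.toEuclideanLin A (hA.eigenvectorBasis j) =
        (hA.eigenvalues j : ℂ) • hA.eigenvectorBasis j := by
      ext k
      have := congrFun (hA.mulVec_eigenvectorBasis j) k
      simpa [Matrix.toLpLin_apply] using this
    rw [h1, inner_smul_right, orthonormal_iff_ite.1 hA.eigenvectorBasis.orthonormal i j]
    split_ifs with h
    · simp [h]
    · simp
  have hu := hA.eigenvectorBasis.orthonormal
  have split : ∀ {τ : Type _} [Fintype τ] (f : τ → ℝ),
      (Finset.univ.filter fun i => f i ≤ E).card +
        (Finset.univ.filter fun i => E < f i).card = Fintype.card τ := by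
    intro τ _ f
    have := Finset.card_filter_add_card_filter_not (s := (Finset.univ : Finset τ))
      (fun i => f i ≤ E)
    simpa only [not_le, Finset.card_univ] using this
  have hn := split hA.eigenvalues
  constructor
  -- The compressed vectors with value `≤ E` are independent of the eigenvectors of `A` with value
  -- `> E`, so the two counts together do not exceed the dimension.
  · have := card_add_card_le_finrank_of_diagonal (Matrix.toEuclideanLin A)
      (fun s : {s // μ s ≤ E} => v s) (fun i : {i // E < hA.eigenvalues i} =>
        hA.eigenvectorBasis i) (hv.comp _ Subtype.val_injective)
      (hu.comp _ Subtype.val_injective) (fun s => μ s) (fun i => hA.eigenvalues i)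
      (fun s t => by simpa [Subtype.ext_iff] using hμ s t)
      (fun s t => by simpa [Subtype.ext_iff] using hν s t) E (fun s => s.2) (fun s => s.2)
    rw [finrank_euclideanSpace, Fintype.card_subtype, Fintype.card_subtype] at this
    omega
  · have := card_add_card_le_finrank_of_diagonal (Matrix.toEuclideanLin A)
      (fun i : {i // hA.eigenvalues i ≤ E} => hA.eigenvectorBasis i)
      (fun s : {s // E < μ s} => v s)
      (hu.comp _ Subtype.val_injective) (hv.comp _ Subtype.val_injective)
      (fun i => hA.eigenvalues i) (fun s => μ s)
      (fun s t => by simpa [Subtype.ext_iff] using hν s t)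
      (fun s t => by simpa [Subtype.ext_iff] using hμ s t) E (fun s => s.2) (fun s => s.2)
    rw [finrank_euclideanSpace, Fintype.card_subtype, Fintype.card_subtype] at this
    omega

end LinearAlgebra

/-! ### Eigenvalue counts of boxes and of separated sub-boxes -/

namespace Anderson

/-- The number of eigenvalues `≤ E` of `H_ω^Λ`. -/
noncomputable def eigCount {d : ℕ} (ω : (Fin d → ℤ) → ℝ) (Λ : Finset (Fin d → ℤ)) (E : ℝ) : ℕ :=
  (Finset.univ.filter fun j : Λ => (isHermitian_boxMatrix ω Λ).eigenvalues j ≤ E).card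

theorem countingFun_eq {d : ℕ} (ω : (Fin d → ℤ) → ℝ) (Λ : Finset (Fin d → ℤ)) (E : ℝ) :
    countingFun ω Λ E = eigCount ω Λ E / Λ.card := rfl

theorem eigCount_le_card {d : ℕ} (ω : (Fin d → ℤ) → ℝ) (Λ : Finset (Fin d → ℤ)) (E : ℝ) :
    eigCount ω Λ E ≤ Λ.card := by
  simpa [eigCount] using Finset.card_filter_le (Finset.univ : Finset Λ)
    (fun j : Λ => (isHermitian_boxMatrix ω Λ).eigenvalues j ≤ E)

theorem card_filter_lt_eigenvalues {d : ℕ} (ω : (Fin d → ℤ) → ℝ) (Λ : Finset (Fin d → ℤ))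
    (E : ℝ) :
    eigCount ω Λ E +
      (Finset.univ.filter fun j : Λ => E < (isHermitian_boxMatrix ω Λ).eigenvalues j).card =
      Λ.card := by
  have := Finset.card_filter_add_card_filter_not (s := (Finset.univ : Finset Λ))
      (fun i => (isHermitian_boxMatrix ω Λ).eigenvalues i ≤ E)
  simpa only [not_le, Finset.card_univ, Fintype.card_coe, eigCount] using this

theorem countingFun_nonneg {d : ℕ} (ω : (Fin d → ℤ) → ℝ) (Λ : Finset (Fin d → ℤ)) (E : ℝ) :
    0 ≤ countingFun ω Λ E := by
  rw [countingFun_eq]; positivity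

theorem countingFun_le_one {d : ℕ} (ω : (Fin d → ℤ) → ℝ) (Λ : Finset (Fin d → ℤ)) (E : ℝ) :
    countingFun ω Λ E ≤ 1 := by
  rw [countingFun_eq]
  exact div_le_one_of_le₀ (by exact_mod_cast eigCount_le_card ω Λ E) (by positivity)

theorem countingFun_mono {d : ℕ} (ω : (Fin d → ℤ) → ℝ) (Λ : Finset (Fin d → ℤ)) :
    Monotone (countingFun ω Λ) := by
  intro E E' h
  rw [countingFun_eq, countingFun_eq]
  gcongr
  exact Finset.card_le_card (Finset.monotone_filter_right _ fun j _ hj => hj.trans h)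

/-- Extension by zero of a vector on `Q` to `Λ`. -/
noncomputable def extVec {d : ℕ} (Λ Q : Finset (Fin d → ℤ)) (f : EuclideanSpace ℂ Q) :
    EuclideanSpace ℂ Λ :=
  WithLp.toLp 2 fun x => if h : x.1 ∈ Q then f ⟨x.1, h⟩ else 0

theorem sum_dite_mem {d : ℕ} {Λ Q : Finset (Fin d → ℤ)} (hQ : Q ⊆ Λ) (F : Q → ℂ) :
    ∑ x : Λ, (if h : x.1 ∈ Q then F ⟨x.1, h⟩ else 0) = ∑ x : Q, F x := by
  symm
  refine Fintype.sum_of_injective (fun x : Q => (⟨x.1, hQ x.2⟩ : Λ)) ?_ _ _ ?_ ?_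
  · intro x y h
    exact Subtype.ext (congrArg (fun z : Λ => z.1) h)
  · intro x hx
    rw [dif_neg]
    intro h
    exact hx ⟨⟨x.1, h⟩, rfl⟩
  · intro x
    simp

theorem inner_extVec {d : ℕ} (ω : (Fin d → ℤ) → ℝ) {Λ Q Q' : Finset (Fin d → ℤ)} (hQ : Q ⊆ Λ)
    (hQ' : Q' ⊆ Λ) (f : EuclideanSpace ℂ Q) (g : EuclideanSpace ℂ Q') :
    inner ℂ (extVec Λ Q f) (Matrix.toEuclideanLin (boxMatrix ω Λ) (extVec Λ Q' g)) =
      ∑ x : Q, ∑ y : Q', star (f x) * (formalOp ω (Pi.single y.1 1) x.1 * g y) := by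
  rw [← sum_dite_mem hQ]
  simp only [PiLp.inner_apply, Matrix.toLpLin_apply, Matrix.mulVec, dotProduct]
  refine Finset.sum_congr rfl fun x _ => ?_
  split_ifs with hx
  · rw [← sum_dite_mem hQ' (fun y => star (f ⟨x, hx⟩) *
      (formalOp ω (Pi.single y.1 1) x.1 * g y))]
    simp only [extVec, hx, dif_pos, RCLike.inner_apply, Finset.sum_mul, boxMatrix_apply]
    refine Finset.sum_congr rfl fun y _ => ?_
    split_ifs
    · simp only [starRingEnd_apply]; ring
    · simp
  · simp [extVec, hx]

theorem inner_extVec_extVec {d : ℕ} {Λ Q Q' : Finset (Fin d → ℤ)} (hQ : Q ⊆ Λ)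
    (f : EuclideanSpace ℂ Q) (g : EuclideanSpace ℂ Q') :
    inner ℂ (extVec Λ Q f) (extVec Λ Q' g) =
      ∑ x : Q, if h : x.1 ∈ Q' then star (f x) * g ⟨x.1, h⟩ else 0 := by
  rw [← sum_dite_mem hQ]
  simp only [PiLp.inner_apply]
  refine Finset.sum_congr rfl fun x _ => ?_
  by_cases hx : x.1 ∈ Q <;> by_cases hx' : x.1 ∈ Q' <;>
    simp [extVec, hx, hx', mul_comm]

/-- Two finite sets of lattice points are separated if they are disjoint and no point of one is a
neighbour of a point of the other. -/
def Separated {d : ℕ} (Q Q' : Finset (Fin d → ℤ)) : Prop :=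
  ∀ x ∈ Q, ∀ y ∈ Q', x ≠ y ∧ ∀ i, x + Pi.single i 1 ≠ y ∧ x - Pi.single i 1 ≠ y

theorem Separated.formalOp_eq_zero {d : ℕ} {Q Q' : Finset (Fin d → ℤ)} (h : Separated Q Q')
    (ω : (Fin d → ℤ) → ℝ) {x y : Fin d → ℤ} (hx : x ∈ Q) (hy : y ∈ Q') :
    formalOp ω (Pi.single y 1) x = 0 := by
  obtain ⟨h1, h2⟩ := h x hx y hy
  simp [formalOp, h1, h2]

/-- Separation kills both the overlaps and the matrix elements between different pieces, so their
eigenvectors extended by zero diagonalize the form on `Λ` and interlacing applies. The second bound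
is interlacing for the eigenvalues `> E`, written additively to avoid natural subtraction. -/
theorem eigCount_bounds_of_separated {d : ℕ} (ω : (Fin d → ℤ) → ℝ) {Λ : Finset (Fin d → ℤ)}
    {J : Type*} [Fintype J] (Q : J → Finset (Fin d → ℤ)) (hQ : ∀ j, Q j ⊆ Λ)
    (hsep : ∀ j k, j ≠ k → Separated (Q j) (Q k)) (E : ℝ) :
    ∑ j, eigCount ω (Q j) E ≤ eigCount ω Λ E ∧
      eigCount ω Λ E + ∑ j, (Q j).card ≤ ∑ j, eigCount ω (Q j) E + Λ.card := by
  classical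
  let v : (Σ j, Q j) → EuclideanSpace ℂ Λ := fun s =>
    extVec Λ (Q s.1) ((isHermitian_boxMatrix ω (Q s.1)).eigenvectorBasis s.2)
  let μ : (Σ j, Q j) → ℝ := fun s => (isHermitian_boxMatrix ω (Q s.1)).eigenvalues s.2
  have hv : Orthonormal ℂ v := by
    rw [orthonormal_iff_ite]
    rintro ⟨j, s⟩ ⟨k, t⟩
    simp only [v]
    rw [inner_extVec_extVec (hQ j)]
    by_cases hjk : j = k
    · subst hjk
      have := orthonormal_iff_ite.1 (isHermitian_boxMatrix ω (Q j)).eigenvectorBasis.orthonormal s t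
      simp only [PiLp.inner_apply, RCLike.inner_apply, starRingEnd_apply] at this
      simp only [Finset.coe_mem, dif_pos, Sigma.mk.injEq, heq_eq_eq, true_and]
      rw [← this]
      exact Finset.sum_congr rfl fun x _ => mul_comm _ _
    · rw [if_neg (by simp [hjk])]
      refine Finset.sum_eq_zero fun x _ => ?_
      rw [dif_neg]
      intro hx
      exact (hsep j k hjk x.1 x.2 x.1 hx).1 rfl
  have hμ : ∀ s t, inner ℂ (v s) (Matrix.toEuclideanLin (boxMatrix ω Λ) (v t)) =
      if s = t then (μ s : ℂ) else 0 := by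
    rintro ⟨j, s⟩ ⟨k, t⟩
    simp only [v]
    rw [inner_extVec ω (hQ j) (hQ k)]
    by_cases hjk : j = k
    · subst hjk
      set hA := isHermitian_boxMatrix ω (Q j) with hAdef
      have h2 := orthonormal_iff_ite.1 hA.eigenvectorBasis.orthonormal s t
      simp only [PiLp.inner_apply, RCLike.inner_apply, starRingEnd_apply] at h2
      have h1 : ∀ x : Q j, ∑ y : Q j, formalOp ω (Pi.single y.1 1) x.1 *
          hA.eigenvectorBasis t y = hA.eigenvalues t * hA.eigenvectorBasis t x := by
        intro x
        have := congrFun (hA.mulVec_eigenvectorBasis t) x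
        simpa [Matrix.mulVec, dotProduct, boxMatrix_apply] using this
      simp only [← Finset.mul_sum, h1, Sigma.mk.injEq, heq_eq_eq, true_and, μ]
      have h3 : ∑ x : Q j, star (hA.eigenvectorBasis s x) *
          (hA.eigenvalues t * hA.eigenvectorBasis t x) =
          hA.eigenvalues t * (if s = t then 1 else 0) := by
        rw [← h2, Finset.mul_sum]
        exact Finset.sum_congr rfl fun x _ => by ring
      rw [h3]
      split_ifs with h
      · simp [h]
      · simp
    · rw [if_neg (by simp [hjk])]
      refine Finset.sum_eq_zero fun x _ => Finset.sum_eq_zero fun y _ => ?_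
      rw [(hsep j k hjk).formalOp_eq_zero ω x.2 y.2]
      simp
  obtain ⟨h1, h2⟩ := card_filter_le_card_eigenvalues (isHermitian_boxMatrix ω Λ) v hv μ hμ E
  have hsum : ∀ p : ℝ → Prop, [DecidablePred p] → (Finset.univ.filter fun s => p (μ s)).card =
      ∑ j, (Finset.univ.filter fun s : Q j =>
        p ((isHermitian_boxMatrix ω (Q j)).eigenvalues s)).card := by
    intro p _
    simp only [Finset.card_filter, Fintype.sum_sigma, μ]
  rw [hsum (fun t => t ≤ E)] at h1
  rw [hsum (fun t => E < t)] at h2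
  refine ⟨h1, ?_⟩
  have h3 : ∑ j, (Q j).card = ∑ j, eigCount ω (Q j) E + ∑ j, (Finset.univ.filter fun s : Q j =>
        E < (isHermitian_boxMatrix ω (Q j)).eigenvalues s).card := by
    rw [← Finset.sum_add_distrib]
    exact Finset.sum_congr rfl fun j _ => (card_filter_lt_eigenvalues ω (Q j) E).symm
  have h4 := card_filter_lt_eigenvalues ω Λ E
  omega

/-- The number of eigenvalues `≤ E` in terms of the characteristic polynomial. -/
theorem eigCount_eq_countP {d : ℕ} (ω : (Fin d → ℤ) → ℝ) (Λ : Finset (Fin d → ℤ)) (E : ℝ) :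
    eigCount ω Λ E = (boxMatrix ω Λ).charpoly.roots.countP (fun z => z.re ≤ E) := by
  classical
  rw [(isHermitian_boxMatrix ω Λ).roots_charpoly_eq_eigenvalues, Multiset.countP_map, eigCount,
    Finset.card_def, Finset.filter_val]
  simp

theorem formalOp_single_add {d : ℕ} (ω : (Fin d → ℤ) → ℝ) (a x y : Fin d → ℤ) :
    formalOp ω (Pi.single (y + a) 1) (x + a) =
      formalOp (fun z => ω (z + a)) (Pi.single y 1) x := by
  have h1 : ∀ e : Fin d → ℤ, x + a + e = y + a ↔ x + e = y := fun e => by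
    rw [add_right_comm, add_left_inj]
  have h2 : ∀ e : Fin d → ℤ, x + a - e = y + a ↔ x - e = y := fun e => by
    rw [add_sub_right_comm, add_left_inj]
  simp [formalOp, Pi.single_apply, h1, h2]

/-- The indexed eigenvalues are tied to the index type, so the comparison goes through the
characteristic polynomial, which reindexing preserves. -/
theorem eigCount_map_add {d : ℕ} (ω : (Fin d → ℤ) → ℝ) (Q : Finset (Fin d → ℤ))
    (a : Fin d → ℤ) (E : ℝ) :
    eigCount ω (Q.map (addRightEmbedding a)) E = eigCount (fun z => ω (z + a)) Q E := by
  have hmem : ∀ x, x ∈ Q ↔ x + a ∈ Q.map (addRightEmbedding a) := by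
    intro x; simp
  let e : Q ≃ (Q.map (addRightEmbedding a) : Finset _) :=
    (Equiv.addRight a).subtypeEquiv hmem
  have h : boxMatrix (fun z => ω (z + a)) Q =
      Matrix.reindex e.symm e.symm (boxMatrix ω (Q.map (addRightEmbedding a))) := by
    ext x y
    rw [Matrix.reindex_apply, Matrix.submatrix_apply, boxMatrix_apply, boxMatrix_apply,
      ← formalOp_single_add]
    rfl
  rw [eigCount_eq_countP, eigCount_eq_countP, h, Matrix.charpoly_reindex]

/-! ### Tiling a cube by cells with one-site gaps -/

/-- The lattice cube with lower corner `a` and side `ℓ`. -/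
noncomputable def cube {d : ℕ} (a : Fin d → ℤ) (ℓ : ℕ) : Finset (Fin d → ℤ) :=
  Fintype.piFinset fun i => Finset.Ico (a i) (a i + ℓ)

theorem mem_cube {d : ℕ} {a : Fin d → ℤ} {ℓ : ℕ} {x : Fin d → ℤ} :
    x ∈ cube a ℓ ↔ ∀ i, a i ≤ x i ∧ x i < a i + ℓ := by
  simp [cube]

theorem card_cube {d : ℕ} (a : Fin d → ℤ) (ℓ : ℕ) : (cube a ℓ).card = ℓ ^ d := by
  simp [cube, Fintype.card_piFinset]

theorem cube_eq_map {d : ℕ} (a : Fin d → ℤ) (ℓ : ℕ) :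
    cube a ℓ = (cube 0 ℓ).map (addRightEmbedding a) := by
  ext x
  simp only [Finset.mem_map, mem_cube, addRightEmbedding_apply, Pi.zero_apply, zero_add]
  constructor
  · intro h
    refine ⟨x - a, fun i => ?_, by simp⟩
    have := h i
    simp only [Pi.sub_apply]
    omega
  · rintro ⟨y, hy, rfl⟩ i
    have := hy i
    simp only [Pi.add_apply]
    omega

theorem box_eq_cube (d : ℕ) {L : ℝ} (hL : 0 < L) :
    ∃ ℓ : ℕ, box d L = cube (fun _ => ⌈-(L / 2)⌉) ℓ ∧ L - 1 < ℓ ∧ (ℓ : ℝ) < L + 1 := by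
  have h1 := Int.ceil_lt_add_one (L / 2)
  have h2 := Int.ceil_lt_add_one (-(L / 2))
  have h3 := Int.le_ceil (L / 2)
  have h4 := Int.le_ceil (-(L / 2))
  have h5 : ⌈-(L / 2)⌉ ≤ ⌈L / 2⌉ := Int.ceil_le_ceil (by linarith)
  have h6 : ((⌈L / 2⌉ - ⌈-(L / 2)⌉).toNat : ℤ) = ⌈L / 2⌉ - ⌈-(L / 2)⌉ :=
    Int.toNat_of_nonneg (by linarith)
  have h7 : ((⌈L / 2⌉ - ⌈-(L / 2)⌉).toNat : ℝ) = ⌈L / 2⌉ - ⌈-(L / 2)⌉ := by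
    exact_mod_cast congrArg (Int.cast : ℤ → ℝ) h6
  refine ⟨(⌈L / 2⌉ - ⌈-(L / 2)⌉).toNat, ?_, ?_, ?_⟩
  · rw [box, cube, h6]
    simp
  · rw [h7]; linarith
  · rw [h7]; linarith

/-- The corners of the cells of a tiling by cubes of side `n`. -/
def cellCorner {d q : ℕ} (a : Fin d → ℤ) (n : ℕ) (j : Fin d → Fin q) : Fin d → ℤ :=
  fun i => a i + n * (j i : ℕ)

/-- The offsets differ by less than `n` in absolute value and also by a multiple of `n`. The range
`-1 ≤ r ≤ b` is a cell side enlarged by one site at each end; the gap of width one leaves just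
enough room for this. -/
theorem cellIndex_eq_of_offsets {n b : ℕ} (hn : n = b + 1) {j k : ℕ} {r s : ℤ} (hr : -1 ≤ r)
    (hr' : r ≤ b) (hs : 0 ≤ s) (hs' : s < b) (h : (n : ℤ) * j + r = n * k + s) : j = k := by
  have hn' : (0 : ℤ) < n := by omega
  have h1 : (n : ℤ) * (j - k) = s - r := by linarith
  have h2 : (n : ℤ) * (j - k) < n * 1 := by rw [h1]; push_cast [hn]; omega
  have h3 : (n : ℤ) * (-1) < n * (j - k) := by rw [h1]; push_cast [hn]; omega
  have h4 := lt_of_mul_lt_mul_left h2 hn'.le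
  have h5 := lt_of_mul_lt_mul_left h3 hn'.le
  omega

theorem separated_cells {d q : ℕ} (a : Fin d → ℤ) (b : ℕ) {j k : Fin d → Fin q} (hjk : j ≠ k) :
    Separated (cube (cellCorner a (b + 1) j) b) (cube (cellCorner a (b + 1) k) b) := by
  have key : ∀ x ∈ cube (cellCorner a (b + 1) j) b, ∀ y ∈ cube (cellCorner a (b + 1) k) b,
      ¬ ∀ i, -1 ≤ y i - x i ∧ y i - x i ≤ 1 := by
    intro x hx y hy h
    rw [mem_cube] at hx hy
    refine hjk (funext fun i => Fin.ext ?_)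
    have h1 := hx i
    have h2 := hy i
    have h3 := h i
    simp only [cellCorner] at h1 h2
    -- Both offsets are those of `y`: relative to its own cell `k`, and relative to cell `j`, which
    -- contains a point within distance one of `y` in each coordinate.
    refine cellIndex_eq_of_offsets (n := b + 1) (b := b) rfl
      (r := y i - a i - ((b + 1 : ℕ) : ℤ) * (j i : ℕ))
      (s := y i - a i - ((b + 1 : ℕ) : ℤ) * (k i : ℕ)) ?_ ?_ ?_ ?_ ?_
    · linarith
    · linarith
    · linarith
    · linarith
    · ring
  intro x hx y hy
  refine ⟨?_, fun i => ⟨?_, ?_⟩⟩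
  · rintro rfl
    exact key x hx x hy (by simp)
  · rintro rfl
    refine key x hx _ hy fun i' => ?_
    by_cases h : i' = i
    · subst h; simp
    · simp [h]
  · rintro rfl
    refine key x hx _ hy fun i' => ?_
    by_cases h : i' = i
    · subst h; simp
    · simp [h]

theorem cell_subset_cube {d q : ℕ} (a : Fin d → ℤ) {b ℓ : ℕ} (hq : (b + 1) * q ≤ ℓ)
    (j : Fin d → Fin q) : cube (cellCorner a (b + 1) j) b ⊆ cube a ℓ := by
  intro x hx
  rw [mem_cube] at hx ⊢
  intro i
  have h1 := hx i
  have h2 : (j i : ℕ) + 1 ≤ q := (j i).2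
  have h3 : (b + 1) * ((j i : ℕ) + 1) ≤ ℓ := (Nat.mul_le_mul_left _ h2).trans hq
  have h4 : ((b + 1 : ℕ) : ℤ) * (j i : ℕ) + (b + 1 : ℕ) ≤ ℓ := by
    have : (((b + 1) * ((j i : ℕ) + 1) : ℕ) : ℤ) ≤ ℓ := by exact_mod_cast h3
    push_cast at this ⊢
    linarith
  have h5 : (0 : ℤ) ≤ ((b + 1 : ℕ) : ℤ) * (j i : ℕ) := by positivity
  simp only [cellCorner] at h1
  push_cast at h1 h4 h5 ⊢
  constructor <;> linarith

/-- Average of the normalized counting functions of the cells. -/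
noncomputable def cellAverage {d : ℕ} (ω : (Fin d → ℤ) → ℝ) (a : Fin d → ℤ) (b q : ℕ) (E : ℝ) : ℝ :=
  (∑ j : Fin d → Fin q, countingFun ω (cube (cellCorner a (b + 1) j) b) E) / (q : ℝ) ^ d

/-- Here `W` counts all sites and `P` the covered ones. Restricting the count to covered sites and
renormalizing by `P` instead of `W` shift the quotient in opposite directions, each by at most the
uncovered fraction, so the errors do not add. -/
theorem abs_div_sub_div_le {S M P W : ℝ} (hS0 : 0 ≤ S) (h1 : S ≤ M) (h2 : M + P ≤ S + W)
    (h3 : S ≤ P) (hP : 0 < P) (hPW : P ≤ W) : |M / W - S / P| ≤ 1 - P / W := by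
  have hW : 0 < W := hP.trans_le hPW
  have hSW : S / W ≤ S / P := div_le_div_of_nonneg_left hS0 hP hPW
  have hdiff : S / P - S / W ≤ 1 - P / W := by
    have : S / P - S / W = (S / P) * (1 - P / W) := by field_simp
    rw [this]
    refine mul_le_of_le_one_left ?_ ((div_le_one hP).2 h3)
    rw [sub_nonneg]; exact (div_le_one hW).2 hPW
  have hMW : M / W ≤ S / W + (1 - P / W) := by
    have : S / W + (1 - P / W) = (S + W - P) / W := by field_simp; ring
    rw [this]
    gcongr
    linarith
  have hMW' : S / W ≤ M / W := by gcongr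
  rw [abs_le]
  constructor <;> linarith

theorem abs_countingFun_sub_cellAverage_le_pow {d : ℕ} (ω : (Fin d → ℤ) → ℝ) (a : Fin d → ℤ)
    {b q ℓ : ℕ} (hb : 0 < b) (hq0 : 0 < q) (hq : (b + 1) * q ≤ ℓ) (E : ℝ) :
    |countingFun ω (cube a ℓ) E - cellAverage ω a b q E| ≤ 1 - ((q * b : ℝ) / ℓ) ^ d := by
  obtain ⟨h1, h2⟩ := eigCount_bounds_of_separated ω (fun j => cube (cellCorner a (b + 1) j) b)
    (cell_subset_cube a hq) (fun j k => separated_cells a b (q := q)) E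
  simp only [card_cube, Finset.sum_const, Finset.card_univ, Fintype.card_pi, Fintype.card_fin,
    Finset.prod_const, smul_eq_mul] at h2
  have hℓ : 0 < ℓ := lt_of_lt_of_le (by positivity) hq
  set S := ∑ j : Fin d → Fin q, eigCount ω (cube (cellCorner a (b + 1) j) b) E with hS
  set M := eigCount ω (cube a ℓ) E with hM
  have hSle : S ≤ q ^ d * b ^ d := by
    have : ∀ j ∈ (Finset.univ : Finset (Fin d → Fin q)),
        eigCount ω (cube (cellCorner a (b + 1) j) b) E ≤ b ^ d := fun j _ => by
      simpa [card_cube] using eigCount_le_card ω (cube (cellCorner a (b + 1) j) b) E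
    simpa using Finset.sum_le_card_nsmul _ _ _ this
  have e1 : cellAverage ω a b q E = S / ((q : ℝ) ^ d * b ^ d) := by
    rw [cellAverage]
    simp only [countingFun_eq, card_cube, ← Finset.sum_div]
    rw [hS]
    push_cast
    rw [div_div, mul_comm]
  rw [e1, countingFun_eq, card_cube, ← hM, div_pow, mul_pow, Nat.cast_pow]
  clear_value S M
  refine abs_div_sub_div_le (by positivity) (by exact_mod_cast h1) (by exact_mod_cast h2)
    (by exact_mod_cast hSle) (by positivity) ?_
  rw [← mul_pow]
  have : q * b ≤ ℓ :=
    (Nat.mul_comm q b ▸ Nat.mul_le_mul_right q (Nat.le_succ b)).trans hq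
  have : (q : ℝ) * b ≤ ℓ := by exact_mod_cast this
  gcongr

/-- By Bernoulli's inequality the uncovered fraction is at most `d` times the one in a single
direction: an incomplete period at the end costs `(b + 1) / ℓ`, and one gap site per period costs `1
/ (b + 1)`. -/
theorem abs_countingFun_sub_cellAverage_le {d : ℕ} (ω : (Fin d → ℤ) → ℝ) (a : Fin d → ℤ)
    {b ℓ : ℕ} (hb : 0 < b) (hℓ : b + 1 ≤ ℓ) (E : ℝ) :
    |countingFun ω (cube a ℓ) E - cellAverage ω a b (ℓ / (b + 1)) E| ≤
      d * (((b : ℝ) + 1) / ℓ + 1 / ((b : ℝ) + 1)) := by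
  set q := ℓ / (b + 1) with hq
  have hq0 : 0 < q := Nat.div_pos hℓ (by omega)
  have hqℓ : (b + 1) * q ≤ ℓ := Nat.mul_div_le _ _
  refine (abs_countingFun_sub_cellAverage_le_pow ω a hb hq0 hqℓ E).trans ?_
  have hℓ0 : (0 : ℝ) < ℓ := by exact_mod_cast (by omega : 0 < ℓ)
  have hn0 : (0 : ℝ) < (b : ℝ) + 1 := by positivity
  have hlt : (ℓ : ℝ) < (b + 1) * q + (b + 1) := by
    have : ℓ < (b + 1) * q + (b + 1) := by
      have h1 := Nat.div_add_mod ℓ (b + 1)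
      have h2 := Nat.mod_lt ℓ (show 0 < b + 1 by omega)
      rw [← hq] at h1
      omega
    exact_mod_cast this
  have hle : ((b : ℝ) + 1) * q ≤ ℓ := by exact_mod_cast hqℓ
  have hr0 : (0 : ℝ) ≤ (q * b : ℝ) / ℓ := by positivity
  have hbern := one_add_mul_le_pow (a := (q * b : ℝ) / ℓ - 1) (by linarith) d
  rw [add_sub_cancel] at hbern
  have hkey : 1 - (q * b : ℝ) / ℓ ≤ ((b : ℝ) + 1) / ℓ + 1 / ((b : ℝ) + 1) := by
    have e : (q * b : ℝ) / ℓ = ((b + 1) * q / ℓ) * (1 - 1 / ((b : ℝ) + 1)) := by field_simp; ring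
    have hu : 1 - ((b : ℝ) + 1) * q / ℓ ≤ ((b : ℝ) + 1) / ℓ := by
      rw [sub_le_iff_le_add, ← add_div, le_div_iff₀ hℓ0]
      linarith
    have hu1 : ((b : ℝ) + 1) * q / ℓ ≤ 1 := (div_le_one hℓ0).2 hle
    have hv : (0 : ℝ) ≤ 1 / ((b : ℝ) + 1) := by positivity
    rw [e]
    nlinarith
  have hd : (0 : ℝ) ≤ d := by positivity
  nlinarith

theorem countingFun_cube {d : ℕ} (ω : (Fin d → ℤ) → ℝ) (a : Fin d → ℤ) (ℓ : ℕ) (E : ℝ) :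
    countingFun ω (cube a ℓ) E = countingFun (fun z => ω (z + a)) (cube 0 ℓ) E := by
  rw [countingFun_eq, countingFun_eq, card_cube, card_cube, cube_eq_map a, eigCount_map_add]

/-! ### Ramps: continuous approximations of the indicator of a half-line -/

/-- The continuous function equal to `1` on `(-∞, E]`, to `0` on `[E + δ, ∞)`, and affine in
between. -/
noncomputable def ramp (δ E t : ℝ) : ℝ := 1 - min 1 (max (t - E) 0 / δ)

theorem continuous_ramp (δ E : ℝ) : Continuous (ramp δ E) := by
  unfold ramp; fun_prop

theorem ramp_nonneg (δ E t : ℝ) : 0 ≤ ramp δ E t := by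
  simp [ramp]

theorem ramp_le_one {δ : ℝ} (hδ : 0 < δ) (E t : ℝ) : ramp δ E t ≤ 1 := by
  have : 0 ≤ max (t - E) 0 / δ := by positivity
  simp [ramp, this]

theorem ramp_of_le (δ : ℝ) {E t : ℝ} (h : t ≤ E) : ramp δ E t = 1 := by
  simp [ramp, max_eq_right (sub_nonpos.2 h)]

theorem ramp_of_ge {δ : ℝ} (hδ : 0 < δ) {E t : ℝ} (h : E + δ ≤ t) : ramp δ E t = 0 := by
  have h1 : δ ≤ max (t - E) 0 := le_max_of_le_left (by linarith)
  simp [ramp, min_eq_left ((one_le_div hδ).2 h1)]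

theorem ramp_mono {δ : ℝ} (hδ : 0 < δ) (t : ℝ) : Monotone fun E => ramp δ E t := by
  intro E E' h
  change ramp δ E t ≤ ramp δ E' t
  unfold ramp
  gcongr

/-- The slope is `1 / δ`; this Lipschitz bound in `E` later gives right-continuity of the density of
states. -/
theorem ramp_le_ramp_add {δ : ℝ} (hδ : 0 < δ) {E E' : ℝ} (h : E ≤ E') (t : ℝ) :
    ramp δ E' t ≤ ramp δ E t + (E' - E) / δ := by
  have h0 : 0 ≤ (E' - E) / δ := div_nonneg (sub_nonneg.2 h) hδ.le
  have h1 : max (t - E) 0 / δ ≤ max (t - E') 0 / δ + (E' - E) / δ := by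
    rw [← add_div]
    gcongr
    refine max_le ?_ ?_
    · have := le_max_left (t - E') 0; linarith
    · have := le_max_right (t - E') 0; linarith
  have h2 : min 1 (max (t - E) 0 / δ) ≤ min 1 (max (t - E') 0 / δ) + (E' - E) / δ := by
    rw [min_add]
    exact le_min ((min_le_left _ _).trans (by linarith)) ((min_le_right _ _).trans h1)
  unfold ramp
  linarith

/-- Factoring out the positive part by a continuous function shows that the ramp of `A` acts as the
identity on the kernel of `(A - E)₊`, the range of the spectral projection. -/
theorem one_sub_ramp {δ : ℝ} (hδ : 0 < δ) (E t : ℝ) :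
    1 - ramp δ E t = (max (t - E) δ)⁻¹ * max (t - E) 0 := by
  unfold ramp
  rw [sub_sub_cancel]
  rcases le_total (t - E) δ with h | h
  · have h1 : max (t - E) 0 ≤ δ := max_le h hδ.le
    rw [max_eq_right h, min_eq_right ((div_le_one hδ).2 h1)]
    ring
  · have h1 : 0 < t - E := hδ.trans_le h
    rw [max_eq_left h, max_eq_left h1.le, min_eq_left ((one_le_div hδ).2 h),
      inv_mul_cancel₀ h1.ne']

/-- Complement of the preceding factorization: on vectors `(A - E)₊ χ` the ramp of `A` is of order
`δ`, hence vanishes in the limit. -/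
theorem ramp_mul_posPart_le {δ : ℝ} (hδ : 0 < δ) (E t : ℝ) :
    ‖ramp δ E t * max (t - E) 0‖ ≤ δ := by
  rw [Real.norm_of_nonneg (mul_nonneg (ramp_nonneg _ _ _) (le_max_right _ _))]
  rcases le_total (t - E) δ with h | h
  · have h1 : max (t - E) 0 ≤ δ := max_le h hδ.le
    have := ramp_le_one hδ E t
    have := ramp_nonneg δ E t
    have := le_max_right (t - E) 0
    nlinarith
  · rw [ramp_of_ge hδ (by linarith), zero_mul]
    exact hδ.le

/-! ### Functional calculus and spectral projections -/

section Hilbert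

variable {H : Type*} [NormedAddCommGroup H] [InnerProductSpace ℂ H] [CompleteSpace H]

theorem cfc_ramp_apply_of_mem_ker {A : H →L[ℂ] H} (hA : IsSelfAdjoint A) {δ : ℝ} (hδ : 0 < δ)
    (E : ℝ) {φ : H} (hφ : cfc (fun t : ℝ => max (t - E) 0) A φ = 0) :
    cfc (ramp δ E) A φ = φ := by
  have h0 : ∀ t : ℝ, max (t - E) δ ≠ 0 := fun t => (hδ.trans_le (le_max_right _ _)).ne'
  have hc : Continuous fun t : ℝ => (max (t - E) δ)⁻¹ := by
    refine Continuous.inv₀ (by fun_prop) h0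
  have h1 : ramp δ E = fun t => 1 - (max (t - E) δ)⁻¹ * max (t - E) 0 := by
    funext t
    rw [← one_sub_ramp hδ, sub_sub_cancel]
  rw [h1, cfc_sub (fun _ => 1) (fun t : ℝ => (max (t - E) δ)⁻¹ * max (t - E) 0) A
    (by fun_prop) (by fun_prop), cfc_const_one ℝ A,
    cfc_mul _ _ A hc.continuousOn (by fun_prop)]
  simp [hφ]

theorem norm_cfc_ramp_le (A : H →L[ℂ] H) {δ : ℝ} (hδ : 0 < δ) (E : ℝ) :
    ‖cfc (ramp δ E) A‖ ≤ 1 := by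
  refine norm_cfc_le zero_le_one fun t _ => ?_
  rw [Real.norm_of_nonneg (ramp_nonneg _ _ _)]
  exact ramp_le_one hδ E t

theorem norm_cfc_ramp_apply_le {A : H →L[ℂ] H} {δ : ℝ} (hδ : 0 < δ) (E : ℝ) (χ : H) :
    ‖cfc (ramp δ E) A (cfc (fun t : ℝ => max (t - E) 0) A χ)‖ ≤ δ * ‖χ‖ := by
  have h1 : cfc (ramp δ E) A (cfc (fun t : ℝ => max (t - E) 0) A χ) =
      cfc (fun t => ramp δ E t * max (t - E) 0) A χ := by
    rw [cfc_mul (ramp δ E) _ A (continuous_ramp δ E).continuousOn (by fun_prop)]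
    rfl
  rw [h1]
  refine (ContinuousLinearMap.le_opNorm _ _).trans ?_
  gcongr
  exact norm_cfc_le hδ.le fun t _ => ramp_mul_posPart_le hδ E t

/-- The spectral projection is the strong limit of the functional calculus of the ramps. -/
theorem tendsto_cfc_ramp {A : H →L[ℂ] H} (hA : IsSelfAdjoint A) (E : ℝ) {δ : ℕ → ℝ}
    (hδ : ∀ k, 0 < δ k) (hlim : Filter.Tendsto δ Filter.atTop (𝓝 0)) (ψ : H) :
    Filter.Tendsto (fun k => cfc (ramp (δ k) E) A ψ) Filter.atTop (𝓝 (spectralProj A E ψ)) := by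
  set B := cfc (fun t : ℝ => max (t - E) 0) A with hB
  have hBsa : IsSelfAdjoint B := cfc_predicate _ A
  have : CompleteSpace (LinearMap.ker B.toLinearMap) := B.isClosed_ker.completeSpace_coe
  have hP : spectralProj A E ψ = (LinearMap.ker B.toLinearMap).starProjection ψ := rfl
  set φ := (LinearMap.ker B.toLinearMap).starProjection ψ with hφ
  have hφmem : B φ = 0 := (LinearMap.ker B.toLinearMap).starProjection_apply_mem ψ
  -- For self-adjoint `B` the orthogonal complement of the kernel is the closure of the range.
  have hperp : ψ - φ ∈ closure (Set.range B) := by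
    have h1 : ψ - φ ∈ (LinearMap.ker B.toLinearMap)ᗮ :=
      Submodule.sub_starProjection_mem_orthogonal ψ
    have h2 := ContinuousLinearMap.orthogonal_ker B
    rw [ContinuousLinearMap.isSelfAdjoint_iff'.1 hBsa] at h2
    rw [show (LinearMap.ker B.toLinearMap)ᗮ = _ from h2] at h1
    exact h1
  rw [hP, Metric.tendsto_atTop]
  intro ε hε
  obtain ⟨_, ⟨χ, rfl⟩, hχ⟩ := Metric.mem_closure_iff.1 hperp (ε / 2) (by positivity)
  have hlim' : Filter.Tendsto (fun k => δ k * ‖χ‖) Filter.atTop (𝓝 0) := by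
    simpa using hlim.mul_const ‖χ‖
  obtain ⟨N, hN⟩ := Filter.eventually_atTop.1 (hlim'.eventually (gt_mem_nhds (half_pos hε)))
  refine ⟨N, fun k hk => ?_⟩
  -- The ramp fixes `φ`, contracts the small remainder `ψ - φ - B χ`, and sends `B χ` to a vector of
  -- norm at most `δ k * ‖χ‖`.
  have e : cfc (ramp (δ k) E) A ψ - φ =
      cfc (ramp (δ k) E) A (ψ - φ - B χ) + cfc (ramp (δ k) E) A (B χ) := by
    rw [map_sub, map_sub, cfc_ramp_apply_of_mem_ker hA (hδ k) E hφmem]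
    abel
  rw [dist_eq_norm, e]
  refine (norm_add_le _ _).trans_lt ?_
  have n1 : ‖cfc (ramp (δ k) E) A (ψ - φ - B χ)‖ ≤ ‖ψ - φ - B χ‖ := by
    refine (ContinuousLinearMap.le_opNorm _ _).trans ?_
    exact mul_le_of_le_one_left (norm_nonneg _) (norm_cfc_ramp_le A (hδ k) E)
  have n2 := norm_cfc_ramp_apply_le (A := A) (hδ k) E χ
  rw [← dist_eq_norm] at n1
  have n3 := hN k hk
  rw [← hB] at n2
  linarith

/-- The quadratic form of the functional calculus. -/
noncomputable def specForm (A : H →L[ℂ] H) (ψ : H) (f : ℝ → ℝ) : ℝ :=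
  (inner ℂ ψ (cfc f A ψ)).re

theorem specForm_mono {A : H →L[ℂ] H} (ψ : H) {f g : ℝ → ℝ}
    (hf : Continuous f) (hg : Continuous g) (h : ∀ t ∈ spectrum ℝ A, f t ≤ g t) :
    specForm A ψ f ≤ specForm A ψ g := by
  have h1 : (0 : H →L[ℂ] H) ≤ cfc (fun t => g t - f t) A :=
    cfc_nonneg fun t ht => sub_nonneg.2 (h t ht)
  rw [cfc_sub g f A hg.continuousOn hf.continuousOn] at h1
  have h2 := ((ContinuousLinearMap.nonneg_iff_isPositive _).1 h1).re_inner_nonneg_right ψ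
  simp only [sub_apply, inner_sub_right, RCLike.re_to_complex,
    Complex.sub_re] at h2
  simp only [specForm]
  linarith

theorem specForm_add_const {A : H →L[ℂ] H} (hA : IsSelfAdjoint A) (ψ : H) {f : ℝ → ℝ}
    (hf : Continuous f) (c : ℝ) :
    specForm A ψ (fun t => f t + c) = specForm A ψ f + c * ‖ψ‖ ^ 2 := by
  simp only [specForm]
  rw [cfc_add_const c f A hf.continuousOn]
  simp only [add_apply, inner_add_right, Complex.add_re, add_right_inj]
  rw [Algebra.algebraMap_eq_smul_one]
  simp only [smul_apply, one_apply_eq_self]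
  rw [← Complex.coe_smul, inner_smul_right, inner_self_eq_norm_sq_to_K]
  simp [← Complex.ofReal_pow]

theorem tendsto_specForm_ramp {A : H →L[ℂ] H} (hA : IsSelfAdjoint A) (E : ℝ) {δ : ℕ → ℝ}
    (hδ : ∀ k, 0 < δ k) (hlim : Filter.Tendsto δ Filter.atTop (𝓝 0)) (ψ : H) :
    Filter.Tendsto (fun k => specForm A ψ (ramp (δ k) E)) Filter.atTop
      (𝓝 (inner ℂ ψ (spectralProj A E ψ)).re) := by
  have h := tendsto_cfc_ramp hA E hδ hlim ψ
  exact (Complex.continuous_re.tendsto _).comp (tendsto_const_nhds.inner h)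

theorem abs_specForm_sub_le {A : H →L[ℂ] H} (hA : IsSelfAdjoint A) {ψ : H} (hψ : ‖ψ‖ = 1)
    {f g : ℝ → ℝ} (hf : Continuous f) (hg : Continuous g) {η : ℝ}
    (h : ∀ t ∈ spectrum ℝ A, |f t - g t| ≤ η) :
    |specForm A ψ f - specForm A ψ g| ≤ η := by
  have h1 := specForm_mono (A := A) ψ hf (hg.add_const η) fun t ht => by
    have := (abs_le.1 (h t ht)).2; linarith
  have h2 := specForm_mono (A := A) ψ hg (hf.add_const η) fun t ht => by
    have := (abs_le.1 (h t ht)).1; linarith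
  rw [specForm_add_const hA ψ hg, hψ] at h1
  rw [specForm_add_const hA ψ hf, hψ] at h2
  rw [abs_le]
  constructor <;> linarith

theorem specForm_eval {A : H →L[ℂ] H} (hA : IsSelfAdjoint A) (ψ : H) (p : Polynomial ℝ) :
    specForm A ψ (fun t => p.eval t) =
      ∑ i ∈ Finset.range (p.natDegree + 1), p.coeff i * (inner ℂ ψ ((A ^ i) ψ)).re := by
  rw [specForm, cfc_polynomial p A hA, Polynomial.aeval_eq_sum_range,
    sum_apply, inner_sum, Complex.re_sum]
  refine Finset.sum_congr rfl fun i _ => ?_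
  rw [smul_apply, ← Complex.coe_smul, inner_smul_right, Complex.re_ofReal_mul]

end Hilbert

/-! ### The Anderson operator on the lattice: self-adjointness, norm, moments -/

section Operator

variable {d : ℕ}

/-- Translation on `ℓ²(ℤ^d)`. -/
noncomputable def shift (e : Fin d → ℤ) (ψ : Ell2 d) : Ell2 d :=
  ⟨fun x => ψ (x + e), memℓp_gen (((lp.memℓp ψ).summable (by norm_num)).comp_injective
    (add_left_injective e))⟩

theorem shift_apply (e : Fin d → ℤ) (ψ : Ell2 d) (x : Fin d → ℤ) : shift e ψ x = ψ (x + e) := rfl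

theorem inner_shift_left (e : Fin d → ℤ) (φ ψ : Ell2 d) :
    inner ℂ (shift e φ) ψ = inner ℂ φ (shift (-e) ψ) := by
  rw [lp.inner_eq_tsum, lp.inner_eq_tsum, ← (Equiv.addRight (-e)).tsum_eq]
  refine tsum_congr fun x => ?_
  simp [shift_apply]

theorem norm_shift (e : Fin d → ℤ) (ψ : Ell2 d) : ‖shift e ψ‖ = ‖ψ‖ := by
  have h : shift (-e) (shift e ψ) = ψ := by
    ext x; simp [shift_apply]
  have h2 : inner ℂ (shift e ψ) (shift e ψ) = inner ℂ ψ ψ := by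
    rw [inner_shift_left, h]
  rw [inner_self_eq_norm_sq_to_K, inner_self_eq_norm_sq_to_K] at h2
  have h3 : ‖shift e ψ‖ ^ 2 = ‖ψ‖ ^ 2 := by exact_mod_cast h2
  exact (pow_left_inj₀ (norm_nonneg _) (norm_nonneg _) two_ne_zero).1 h3

/-- Multiplication by a bounded potential. -/
theorem exists_mulPotential {ω : (Fin d → ℤ) → ℝ} {R : ℝ} (hR : ∀ k, |ω k| ≤ R) (ψ : Ell2 d) :
    ∃ χ : Ell2 d, (∀ x, χ x = ω x * ψ x) ∧ ‖χ‖ ≤ R * ‖ψ‖ := by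
  have hR0 : 0 ≤ R := (abs_nonneg _).trans (hR 0)
  have hx : ∀ x, ‖(ω x : ℂ) * ψ x‖ ^ (2 : ℝ≥0∞).toReal ≤
      R ^ (2 : ℝ≥0∞).toReal * ‖ψ x‖ ^ (2 : ℝ≥0∞).toReal := fun x => by
    rw [norm_mul, Real.mul_rpow (norm_nonneg _) (norm_nonneg _)]
    have : ‖(ω x : ℂ)‖ ≤ R := by simpa using hR x
    gcongr
  have hs := (((lp.memℓp ψ).summable (by norm_num)).mul_left (R ^ (2 : ℝ≥0∞).toReal))
  have hs' : Summable fun x => ‖(ω x : ℂ) * ψ x‖ ^ (2 : ℝ≥0∞).toReal :=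
    Summable.of_nonneg_of_le (fun x => by positivity) hx hs
  refine ⟨⟨fun x => (ω x : ℂ) * ψ x, memℓp_gen hs'⟩, fun x => rfl, ?_⟩
  refine lp.norm_le_of_tsum_le (by norm_num) (by positivity) ?_
  rw [Real.mul_rpow hR0 (norm_nonneg _), lp.norm_rpow_eq_tsum (by norm_num), ← tsum_mul_left]
  exact hs'.tsum_le_tsum hx hs

/-- The operator is a sum of translations and a real multiplication. Translation by `-e` is the
adjoint of translation by `e`, and the terms `± e_i` occur in pairs. -/
theorem isSelfAdjoint_op {ω : (Fin d → ℤ) → ℝ} {R : ℝ} (hR : ∀ k, |ω k| ≤ R) :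
    IsSelfAdjoint (op ω) ∧ ‖op ω‖ ≤ 4 * d + R := by
  have hR0 : 0 ≤ R := (abs_nonneg _).trans (hR 0)
  choose M hM hMn using fun ψ => exists_mulPotential (d := d) hR ψ
  have hop : ∀ ψ, op ω ψ = ∑ i : Fin d, ((ψ - shift (Pi.single i 1) ψ) +
      (ψ - shift (-Pi.single i 1) ψ)) + M ψ := by
    intro ψ
    ext x
    rw [op_apply ⟨R, hR⟩]
    simp only [formalOp, LinearMap.coe_mk, AddHom.coe_mk, lp.coeFn_add, Pi.add_apply, hM,
      lp.coeFn_sum, Finset.sum_apply, lp.coeFn_sub, Pi.sub_apply, shift_apply]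
    simp only [sub_eq_add_neg]
  have hMs : ∀ φ ψ, inner ℂ (M φ) ψ = inner ℂ φ (M ψ) := by
    intro φ ψ
    rw [lp.inner_eq_tsum, lp.inner_eq_tsum]
    refine tsum_congr fun x => ?_
    simp only [hM, RCLike.inner_apply, map_mul, Complex.conj_ofReal]
    ring
  constructor
  · rw [ContinuousLinearMap.isSelfAdjoint_iff_isSymmetric]
    intro φ ψ
    change inner ℂ (op ω φ) ψ = inner ℂ φ (op ω ψ)
    rw [hop, hop]
    simp only [inner_add_left, inner_add_right, sum_inner, inner_sum, inner_sub_left,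
      inner_sub_right, hMs, inner_shift_left, neg_neg]
    congr 1
    exact Finset.sum_congr rfl fun i _ => by ring
  · refine ContinuousLinearMap.opNorm_le_bound _ (by positivity) fun ψ => ?_
    rw [hop, add_mul]
    refine (norm_add_le _ _).trans (add_le_add ?_ (hMn ψ))
    refine (norm_sum_le _ _).trans ?_
    have h1 : ∀ i ∈ (Finset.univ : Finset (Fin d)), ‖(ψ - shift (Pi.single i 1) ψ) +
        (ψ - shift (-Pi.single i 1) ψ)‖ ≤ 4 * ‖ψ‖ := by
      intro i _
      refine (norm_add_le _ _).trans ?_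
      have h1 := norm_sub_le ψ (shift (Pi.single i 1) ψ)
      have h2 := norm_sub_le ψ (shift (-Pi.single i 1) ψ)
      rw [norm_shift] at h1 h2
      linarith
    refine (Finset.sum_le_card_nsmul _ _ _ h1).trans (le_of_eq ?_)
    simp
    ring

theorem abs_le_of_mem_spectrum_op {ω : (Fin d → ℤ) → ℝ} {R : ℝ} (hR : ∀ k, |ω k| ≤ R) {t : ℝ}
    (ht : t ∈ spectrum ℝ (op ω)) : |t| ≤ 4 * d + R := by
  have h1 := spectrum.norm_le_norm_mul_of_mem ht
  have h2 : ‖(1 : Ell2 d →L[ℂ] Ell2 d)‖ ≤ 1 := ContinuousLinearMap.norm_id_le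
  calc |t| ≤ ‖op ω‖ * ‖(1 : Ell2 d →L[ℂ] Ell2 d)‖ := h1
    _ ≤ ‖op ω‖ * 1 := by gcongr
    _ ≤ 4 * d + R := by rw [mul_one]; exact (isSelfAdjoint_op hR).2

/-- The diagonal matrix element of a power of `H_ω` at the lattice point `x`. -/
noncomputable def moment (ω : (Fin d → ℤ) → ℝ) (k : ℕ) (x : Fin d → ℤ) : ℂ :=
  ((formalOp ω) ^ k) (Pi.single x 1) x

theorem op_pow_apply {ω : (Fin d → ℤ) → ℝ} (h : ∃ R, ∀ k, |ω k| ≤ R) (n : ℕ) (ψ : Ell2 d) :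
    (((op ω) ^ n) ψ : (Fin d → ℤ) → ℂ) = ((formalOp ω) ^ n) (ψ : (Fin d → ℤ) → ℂ) := by
  induction n with
  | zero => rfl
  | succ n ih =>
    rw [pow_succ', pow_succ']
    change ((op ω ((op ω ^ n) ψ) : Ell2 d) : (Fin d → ℤ) → ℂ) = formalOp ω (((formalOp ω) ^ n) ψ)
    rw [← ih]
    funext x
    exact op_apply h _ x

theorem specForm_polynomial {ω : (Fin d → ℤ) → ℝ} {R : ℝ} (hR : ∀ k, |ω k| ≤ R)
    (p : Polynomial ℝ) (x : Fin d → ℤ) :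
    specForm (op ω) (lp.single 2 x (1 : ℂ) : Ell2 d) (fun t => p.eval t) =
      ∑ i ∈ Finset.range (p.natDegree + 1), p.coeff i * (moment ω i x).re := by
  rw [specForm_eval (isSelfAdjoint_op hR).1]
  refine Finset.sum_congr rfl fun i _ => ?_
  rw [lp.inner_single_left, op_pow_apply ⟨R, hR⟩, moment]
  congr 2
  have : ((lp.single 2 x (1 : ℂ) : Ell2 d) : (Fin d → ℤ) → ℂ) = Pi.single x 1 := by
    ext y; simp [lp.single_apply, Pi.single_apply]
  rw [this]
  simp

theorem norm_formalOp_le {ω : (Fin d → ℤ) → ℝ} {R : ℝ} (hR : ∀ k, |ω k| ≤ R)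
    {ψ : (Fin d → ℤ) → ℂ} {c : ℝ} (hψ : ∀ y, ‖ψ y‖ ≤ c) (x : Fin d → ℤ) :
    ‖formalOp ω ψ x‖ ≤ (4 * d + R) * c := by
  have hR0 : 0 ≤ R := (abs_nonneg _).trans (hR 0)
  simp only [formalOp, LinearMap.coe_mk, AddHom.coe_mk]
  rw [add_mul]
  refine (norm_add_le _ _).trans (add_le_add ?_ ?_)
  · refine (norm_sum_le _ _).trans ?_
    have h1 : ∀ i ∈ (Finset.univ : Finset (Fin d)), ‖(ψ x - ψ (x + Pi.single i 1)) +
        (ψ x - ψ (x - Pi.single i 1))‖ ≤ 4 * c := by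
      intro i _
      refine (norm_add_le _ _).trans ?_
      have h1 := norm_sub_le (ψ x) (ψ (x + Pi.single i 1))
      have h2 := norm_sub_le (ψ x) (ψ (x - Pi.single i 1))
      linarith [hψ x, hψ (x + Pi.single i 1), hψ (x - Pi.single i 1)]
    refine (Finset.sum_le_card_nsmul _ _ _ h1).trans (le_of_eq ?_)
    simp
    ring
  · rw [norm_mul]
    have : ‖(ω x : ℂ)‖ ≤ R := by simpa using hR x
    exact mul_le_mul this (hψ x) (norm_nonneg _) hR0

theorem norm_formalOp_pow_le {ω : (Fin d → ℤ) → ℝ} {R : ℝ} (hR : ∀ k, |ω k| ≤ R) (k : ℕ)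
    (x y : Fin d → ℤ) : ‖((formalOp ω) ^ k) (Pi.single x 1) y‖ ≤ (4 * d + R) ^ k := by
  induction k generalizing y with
  | zero =>
    by_cases h : y = x
    · subst h; simp
    · simp [h]
  | succ k ih =>
    rw [pow_succ', pow_succ']
    exact norm_formalOp_le hR ih y

/-- Finite propagation: each application of the operator moves the support by at most one site. -/
theorem formalOp_pow_single_eq_zero (ω : (Fin d → ℤ) → ℝ) (k : ℕ) (x y : Fin d → ℤ)
    (h : ∃ i, (k : ℤ) < |y i - x i|) : ((formalOp ω) ^ k) (Pi.single x 1) y = 0 := by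
  induction k generalizing y with
  | zero =>
    obtain ⟨i, hi⟩ := h
    have : y ≠ x := by rintro rfl; simp at hi
    simp [this]
  | succ k ih =>
    obtain ⟨i, hi⟩ := h
    have hnb : ∀ z : Fin d → ℤ, |z i - y i| ≤ 1 → ((formalOp ω) ^ k) (Pi.single x 1) z = 0 := by
      intro z hz
      refine ih z ⟨i, ?_⟩
      have := abs_sub_le (y i) (z i) (x i)
      rw [abs_sub_comm (y i) (z i)] at this
      push_cast at hi
      linarith
    have hs : ∀ j : Fin d, |(Pi.single j (1 : ℤ) : Fin d → ℤ) i| ≤ 1 := by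
      intro j
      by_cases h : i = j
      · subst h; simp
      · simp [h]
    rw [pow_succ']
    change formalOp ω (((formalOp ω) ^ k) (Pi.single x 1)) y = 0
    have h0 := hnb y (by simp)
    have h1 := fun j => hnb (y + Pi.single j 1) (by simpa using hs j)
    have h2 := fun j => hnb (y - Pi.single j 1) (by simpa using hs j)
    generalize ((formalOp ω) ^ k) (Pi.single x 1) = φ at h0 h1 h2
    simp [formalOp, h0, h1, h2]

theorem formalOp_translate (ω : (Fin d → ℤ) → ℝ) (a : Fin d → ℤ) (ψ : (Fin d → ℤ) → ℂ) :
    (fun x => formalOp ω ψ (x + a)) = formalOp (fun z => ω (z + a)) fun x => ψ (x + a) := by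
  funext x
  have h1 : ∀ e : Fin d → ℤ, x + a + e = x + e + a := fun e => add_right_comm _ _ _
  have h2 : ∀ e : Fin d → ℤ, x + a - e = x - e + a := fun e => add_sub_right_comm _ _ _
  simp [formalOp, h1, h2]

theorem moment_eq_moment_zero (ω : (Fin d → ℤ) → ℝ) (k : ℕ) (a : Fin d → ℤ) :
    moment ω k a = moment (fun z => ω (z + a)) k 0 := by
  have key : (fun x => ((formalOp ω) ^ k) (Pi.single a 1) (x + a)) =
      ((formalOp fun z => ω (z + a)) ^ k) (Pi.single 0 1) := by
    induction k with
    | zero =>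
      funext x
      simp [Pi.single_apply]
    | succ k ih =>
      rw [pow_succ', pow_succ']
      change (fun x => formalOp ω (((formalOp ω) ^ k) (Pi.single a 1)) (x + a)) =
        formalOp (fun z => ω (z + a)) (((formalOp fun z => ω (z + a)) ^ k) (Pi.single 0 1))
      rw [← ih, formalOp_translate]
  have := congrFun key 0
  simpa [moment] using this

end Operator

/-! ### Box matrices: eigenvalue bounds and traces of powers -/

section Matrix

variable {d : ℕ}

/-- Extension by zero of a function on `Λ`. -/
noncomputable def extFun (Λ : Finset (Fin d → ℤ)) (v : Λ → ℂ) : (Fin d → ℤ) → ℂ :=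
  Function.extend Subtype.val v 0

theorem extFun_apply {Λ : Finset (Fin d → ℤ)} (v : Λ → ℂ) (x : Λ) : extFun Λ v x = v x :=
  Subtype.val_injective.extend_apply v 0 x

theorem extFun_of_notMem {Λ : Finset (Fin d → ℤ)} (v : Λ → ℂ) {x : Fin d → ℤ} (hx : x ∉ Λ) :
    extFun Λ v x = 0 := by
  rw [extFun, Function.extend_apply' _ _ _ (by rintro ⟨a, rfl⟩; exact hx a.2)]
  rfl

theorem norm_extFun_le {Λ : Finset (Fin d → ℤ)} {v : Λ → ℂ} {c : ℝ} (hc : 0 ≤ c)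
    (hv : ∀ x, ‖v x‖ ≤ c) (x : Fin d → ℤ) : ‖extFun Λ v x‖ ≤ c := by
  by_cases hx : x ∈ Λ
  · exact (extFun_apply v ⟨x, hx⟩).symm ▸ hv ⟨x, hx⟩
  · simpa [extFun_of_notMem v hx] using hc

theorem boxMatrix_mulVec (ω : (Fin d → ℤ) → ℝ) (Λ : Finset (Fin d → ℤ)) (v : Λ → ℂ) (x : Λ) :
    (boxMatrix ω Λ).mulVec v x = formalOp ω (extFun Λ v) x := by
  rw [boxMatrix, LinearMap.toMatrix'_mulVec]
  rfl

/-- Evaluate the eigenvalue equation at a site where the eigenvector has maximal modulus. -/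
theorem abs_eigenvalues_boxMatrix_le {ω : (Fin d → ℤ) → ℝ} {R : ℝ} (hR : ∀ k, |ω k| ≤ R)
    (Λ : Finset (Fin d → ℤ)) (j : Λ) :
    |(isHermitian_boxMatrix ω Λ).eigenvalues j| ≤ 4 * d + R := by
  set hA := isHermitian_boxMatrix ω Λ
  set v : EuclideanSpace ℂ Λ := hA.eigenvectorBasis j
  obtain ⟨x, -, hx⟩ := Finset.exists_max_image (Finset.univ : Finset Λ) (fun x => ‖v x‖)
    ⟨j, Finset.mem_univ j⟩
  have hv0 : 0 < ‖v x‖ := by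
    by_contra h
    have h0 : ∀ y, v y = 0 := fun y =>
      norm_le_zero_iff.1 ((hx y (Finset.mem_univ y)).trans (not_lt.1 h))
    have hv : v = 0 := by ext y; exact h0 y
    have h1 : ‖v‖ = 1 := hA.eigenvectorBasis.orthonormal.1 j
    rw [hv, norm_zero] at h1
    exact zero_ne_one h1
  have h1 := congrFun (hA.mulVec_eigenvectorBasis j) x
  rw [boxMatrix_mulVec] at h1
  have h2 := norm_formalOp_le hR (norm_extFun_le (norm_nonneg (v x)) fun y =>
    hx y (Finset.mem_univ y)) x.1
  rw [h1] at h2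
  simp only [Pi.smul_apply, norm_smul] at h2
  exact le_of_mul_le_mul_right h2 hv0

theorem norm_boxMatrix_pow_mulVec_le {ω : (Fin d → ℤ) → ℝ} {R : ℝ} (hR : ∀ k, |ω k| ≤ R)
    (Λ : Finset (Fin d → ℤ)) (k : ℕ) (x y : Λ) :
    ‖((boxMatrix ω Λ) ^ k).mulVec (Pi.single x 1) y‖ ≤ (4 * d + R) ^ k := by
  have hR0 : 0 ≤ R := (abs_nonneg _).trans (hR 0)
  induction k generalizing y with
  | zero =>
    by_cases h : y = x
    · subst h; simp
    · simp [h]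
  | succ k ih =>
    rw [pow_succ', pow_succ', ← Matrix.mulVec_mulVec, boxMatrix_mulVec]
    exact norm_formalOp_le hR (norm_extFun_le (by positivity) ih) _

theorem norm_boxMatrix_pow_apply_le {ω : (Fin d → ℤ) → ℝ} {R : ℝ} (hR : ∀ k, |ω k| ≤ R)
    (Λ : Finset (Fin d → ℤ)) (k : ℕ) (x : Λ) :
    ‖((boxMatrix ω Λ) ^ k) x x‖ ≤ (4 * d + R) ^ k := by
  simpa using norm_boxMatrix_pow_mulVec_le hR Λ k x x

/-- When the box contains all points within distance `k` of `x`, the first `k` iterates of `δ_x`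
stay inside it, so truncation has no effect. -/
theorem boxMatrix_pow_apply_eq_moment (ω : (Fin d → ℤ) → ℝ) (Λ : Finset (Fin d → ℤ)) (k : ℕ)
    (x : Λ) (hx : ∀ y : Fin d → ℤ, (∀ i, |y i - x.1 i| ≤ k) → y ∈ Λ) :
    ((boxMatrix ω Λ) ^ k) x x = moment ω k x := by
  have key : ∀ m ≤ k, extFun Λ (((boxMatrix ω Λ) ^ m).mulVec (Pi.single x 1)) =
      ((formalOp ω) ^ m) (Pi.single x.1 1) := by
    intro m hm
    have hsupp : ∀ y ∉ Λ, ((formalOp ω) ^ m) (Pi.single x.1 1) y = 0 := by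
      intro y hy
      refine formalOp_pow_single_eq_zero ω m x y ?_
      by_contra! h
      exact hy (hx y fun i => (h i).trans (by exact_mod_cast hm))
    induction m with
    | zero =>
      funext y
      by_cases hy : y ∈ Λ
      · rw [show y = (⟨y, hy⟩ : Λ).1 from rfl, extFun_apply]
        rw [pow_zero, pow_zero, Matrix.one_mulVec, Module.End.one_apply]
        simp only [Pi.single_apply, Subtype.ext_iff]
      · rw [extFun_of_notMem _ hy, hsupp y hy]
    | succ m ih =>
      have ih' := ih (by omega) (by
        intro y hy
        refine formalOp_pow_single_eq_zero ω m x y ?_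
        by_contra! h
        exact hy (hx y fun i => (h i).trans (by exact_mod_cast (by omega : m ≤ k))))
      funext y
      by_cases hy : y ∈ Λ
      · rw [show y = (⟨y, hy⟩ : Λ).1 from rfl, extFun_apply, pow_succ', ← Matrix.mulVec_mulVec,
          boxMatrix_mulVec, ih', pow_succ']
        rfl
      · rw [extFun_of_notMem _ hy, hsupp y hy]
  have h := congrFun (key k le_rfl) x
  rw [extFun_apply] at h
  simpa [moment] using h

theorem sum_eigenvalues_pow (ω : (Fin d → ℤ) → ℝ) (Λ : Finset (Fin d → ℤ)) (k : ℕ) :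
    ∑ j, (isHermitian_boxMatrix ω Λ).eigenvalues j ^ k =
      ∑ x, (((boxMatrix ω Λ) ^ k) x x).re := by
  set hA := isHermitian_boxMatrix ω Λ
  have h1 : (boxMatrix ω Λ) ^ k = Unitary.conjStarAlgAut ℂ _ hA.eigenvectorUnitary
      ((Matrix.diagonal (RCLike.ofReal ∘ hA.eigenvalues)) ^ k) := by
    rw [map_pow, ← hA.spectral_theorem]
  have h2 : Matrix.trace ((boxMatrix ω Λ) ^ k) = ∑ j, (hA.eigenvalues j : ℂ) ^ k := by
    rw [h1, Unitary.conjStarAlgAut_apply, Matrix.trace_mul_cycle, Unitary.coe_star_mul_self,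
      one_mul, Matrix.diagonal_pow, Matrix.trace_diagonal]
    rfl
  have h3 := congrArg Complex.re h2
  rw [Matrix.trace, Complex.re_sum, Complex.re_sum] at h3
  simp only [Matrix.diag_apply] at h3
  rw [h3]
  exact Finset.sum_congr rfl fun j _ => by rw [← Complex.ofReal_pow, Complex.ofReal_re]

theorem sum_eigenvalues_polynomial (ω : (Fin d → ℤ) → ℝ) (Λ : Finset (Fin d → ℤ))
    (p : Polynomial ℝ) :
    ∑ j, p.eval ((isHermitian_boxMatrix ω Λ).eigenvalues j) =
      ∑ i ∈ Finset.range (p.natDegree + 1), p.coeff i *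
        ∑ x, (((boxMatrix ω Λ) ^ i) x x).re := by
  simp only [Polynomial.eval_eq_sum_range, ← sum_eigenvalues_pow, Finset.mul_sum]
  exact Finset.sum_comm

end Matrix

/-! ### Stationarity and measurability -/

variable {d : ℕ}

instance isProbabilityMeasure_law (μ : ProbabilityMeasure ℝ) : IsProbabilityMeasure (law d μ) := by
  unfold law; infer_instance

/-- Since `op` is `0` by default for unbounded potentials, statements about it are made almost
surely through this bound. -/
theorem exists_ae_law_abs_le {μ : ProbabilityMeasure ℝ}
    (h : Bornology.IsBounded (μ : Measure ℝ).support) :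
    ∃ R : ℝ, ∀ᵐ ω ∂(law d μ), ∀ k, |ω k| ≤ R := by
  obtain ⟨R, hR⟩ := h.subset_closedBall 0
  refine ⟨R, ae_all_iff.2 fun k => ?_⟩
  have h1 : ∀ᵐ t ∂(μ : Measure ℝ), |t| ≤ R := by
    filter_upwards [Measure.support_mem_ae (μ := (μ : Measure ℝ))] with t ht
    simpa using hR ht
  exact (measurePreserving_eval_infinitePi
    (fun _ : Fin d → ℤ => (μ : Measure ℝ)) k).quasiMeasurePreserving.ae h1

theorem measurePreserving_translate (μ : ProbabilityMeasure ℝ) (a : Fin d → ℤ) :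
    MeasurePreserving (fun (ω : (Fin d → ℤ) → ℝ) z => ω (z + a)) (law d μ) (law d μ) := by
  refine ⟨by fun_prop, ?_⟩
  exact Measure.map_infinitePi_infinitePi_of_inj (P := fun _ : Fin d → ℤ => (μ : Measure ℝ))
    (f := fun z => z + a) (add_left_injective a)

theorem measurable_formalOp_pow (k : ℕ) (x y : Fin d → ℤ) :
    Measurable fun ω : (Fin d → ℤ) → ℝ => ((formalOp ω) ^ k) (Pi.single x 1) y := by
  induction k generalizing y with
  | zero => exact measurable_const
  | succ k ih =>
    have h : ∀ ω : (Fin d → ℤ) → ℝ, ((formalOp ω) ^ (k + 1)) (Pi.single x 1) y =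
        formalOp ω (((formalOp ω) ^ k) (Pi.single x 1)) y := fun ω => by rw [pow_succ']; rfl
    simp only [h]
    exact (Finset.measurable_sum _ fun i _ => ((ih _).sub (ih _)).add ((ih _).sub (ih _))).add
      ((Complex.measurable_ofReal.comp (measurable_pi_apply y)).mul (ih _))

theorem measurable_moment (k : ℕ) (x : Fin d → ℤ) :
    Measurable fun ω : (Fin d → ℤ) → ℝ => (moment ω k x).re :=
  Complex.measurable_re.comp (measurable_formalOp_pow k x x)

theorem measurable_boxMatrix_pow (Λ : Finset (Fin d → ℤ)) (k : ℕ) (x y : Λ) :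
    Measurable fun ω : (Fin d → ℤ) → ℝ => ((boxMatrix ω Λ) ^ k) x y := by
  induction k generalizing y with
  | zero => simp only [pow_zero]; exact measurable_const
  | succ k ih =>
    simp only [pow_succ, Matrix.mul_apply]
    refine Finset.measurable_sum _ fun z _ => (ih z).mul ?_
    simp only [boxMatrix_apply]
    simpa using measurable_formalOp_pow 1 y.1 z.1

/-- Approximating on the growing intervals `[-n, n]` makes one sequence serve every bounded
spectrum, which is what measurability in `ω` needs. -/
theorem exists_polynomial_seq {f : ℝ → ℝ} (hf : Continuous f) :
    ∃ p : ℕ → Polynomial ℝ, ∀ t, Filter.Tendsto (fun n => (p n).eval t) Filter.atTop (𝓝 (f t)) ∧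
      ∀ n : ℕ, |t| ≤ n → |(p n).eval t - f t| ≤ 1 / ((n : ℝ) + 1) := by
  have h : ∀ n : ℕ, ∃ p : Polynomial ℝ, ∀ t ∈ Set.Icc (-(n : ℝ)) n,
      |p.eval t - f t| < 1 / ((n : ℝ) + 1) := fun n =>
    exists_polynomial_near_of_continuousOn _ _ f hf.continuousOn _ (by positivity)
  choose p hp using h
  have hle : ∀ t : ℝ, ∀ n : ℕ, |t| ≤ n → |(p n).eval t - f t| ≤ 1 / ((n : ℝ) + 1) := fun t n hn =>
    (hp n t (abs_le.1 hn)).le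
  refine ⟨p, fun t => ⟨?_, hle t⟩⟩
  obtain ⟨N, hN⟩ := exists_nat_ge |t|
  rw [tendsto_iff_norm_sub_tendsto_zero]
  refine squeeze_zero' (Filter.Eventually.of_forall fun n => norm_nonneg _) ?_
    tendsto_one_div_add_atTop_nhds_zero_nat
  filter_upwards [Filter.eventually_ge_atTop N] with n hn
  exact hle t n (hN.trans (by exact_mod_cast hn))

/-- The average of `f` over the eigenvalues of `H_ω^Λ`. -/
noncomputable def boxMean (ω : (Fin d → ℤ) → ℝ) (Λ : Finset (Fin d → ℤ)) (f : ℝ → ℝ) : ℝ :=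
  (∑ j, f ((isHermitian_boxMatrix ω Λ).eigenvalues j)) / Λ.card

theorem countingFun_eq_boxMean (ω : (Fin d → ℤ) → ℝ) (Λ : Finset (Fin d → ℤ)) (E : ℝ) :
    countingFun ω Λ E = boxMean ω Λ fun t => if t ≤ E then 1 else 0 := by
  rw [countingFun, boxMean, Finset.card_filter]
  push_cast
  rfl

theorem boxMean_mono (ω : (Fin d → ℤ) → ℝ) (Λ : Finset (Fin d → ℤ)) {f g : ℝ → ℝ}
    (h : ∀ j, f ((isHermitian_boxMatrix ω Λ).eigenvalues j) ≤
      g ((isHermitian_boxMatrix ω Λ).eigenvalues j)) : boxMean ω Λ f ≤ boxMean ω Λ g := by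
  unfold boxMean
  gcongr with j
  exact h j

theorem countingFun_le_boxMean_ramp (ω : (Fin d → ℤ) → ℝ) (Λ : Finset (Fin d → ℤ)) (δ E : ℝ) :
    countingFun ω Λ E ≤ boxMean ω Λ (ramp δ E) := by
  rw [countingFun_eq_boxMean]
  refine boxMean_mono ω Λ fun j => ?_
  split_ifs with h
  · rw [ramp_of_le δ h]
  · exact ramp_nonneg _ _ _

theorem boxMean_ramp_le_countingFun (ω : (Fin d → ℤ) → ℝ) (Λ : Finset (Fin d → ℤ)) {δ : ℝ}
    (hδ : 0 < δ) (E : ℝ) : boxMean ω Λ (ramp δ E) ≤ countingFun ω Λ (E + δ) := by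
  rw [countingFun_eq_boxMean]
  refine boxMean_mono ω Λ fun j => ?_
  split_ifs with h
  · exact ramp_le_one hδ _ _
  · exact (ramp_of_ge hδ (not_le.1 h).le).le

theorem tendsto_boxMean (ω : (Fin d → ℤ) → ℝ) (Λ : Finset (Fin d → ℤ)) {f : ℕ → ℝ → ℝ}
    {g : ℝ → ℝ} (h : ∀ t, Filter.Tendsto (fun n => f n t) Filter.atTop (𝓝 (g t))) :
    Filter.Tendsto (fun n => boxMean ω Λ (f n)) Filter.atTop (𝓝 (boxMean ω Λ g)) :=
  (tendsto_finsetSum _ fun _ _ => h _).div_const _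

theorem abs_boxMean_sub_le (ω : (Fin d → ℤ) → ℝ) {Λ : Finset (Fin d → ℤ)}
    {f g : ℝ → ℝ} {η : ℝ} (hη : 0 ≤ η)
    (h : ∀ j, |f ((isHermitian_boxMatrix ω Λ).eigenvalues j) -
      g ((isHermitian_boxMatrix ω Λ).eigenvalues j)| ≤ η) :
    |boxMean ω Λ f - boxMean ω Λ g| ≤ η := by
  rw [boxMean, boxMean, ← sub_div, ← Finset.sum_sub_distrib, abs_div, Nat.abs_cast]
  refine div_le_of_le_mul₀ (by positivity) hη ?_
  refine (Finset.abs_sum_le_sum_abs _ _).trans ?_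
  refine (Finset.sum_le_card_nsmul _ _ _ fun j _ => h j).trans (le_of_eq ?_)
  simp [mul_comm]

/-- Measurability of individual eigenvalues is never needed: their power sums are traces, hence
measurable, and polynomials approximate `f`. -/
theorem measurable_boxMean {f : ℝ → ℝ} (hf : Continuous f) (Λ : Finset (Fin d → ℤ)) :
    Measurable fun ω => boxMean ω Λ f := by
  obtain ⟨p, hp⟩ := exists_polynomial_seq hf
  refine measurable_of_tendsto_metrizable (f := fun n ω => boxMean ω Λ fun t => (p n).eval t) ?_
    (tendsto_pi_nhds.2 fun ω => tendsto_boxMean ω Λ fun t => (hp t).1)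
  intro n
  simp only [boxMean, sum_eigenvalues_polynomial]
  exact (Finset.measurable_sum _ fun i _ => (Finset.measurable_sum _ fun x _ =>
    Complex.measurable_re.comp (measurable_boxMatrix_pow Λ i x x)).const_mul _).div_const _

theorem tendsto_ramp (E t : ℝ) {δ : ℕ → ℝ} (hδ : ∀ k, 0 < δ k)
    (hlim : Filter.Tendsto δ Filter.atTop (𝓝 0)) :
    Filter.Tendsto (fun k => ramp (δ k) E t) Filter.atTop (𝓝 (if t ≤ E then 1 else 0)) := by
  split_ifs with h
  · simp only [ramp_of_le _ h]
    exact tendsto_const_nhds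
  · refine tendsto_const_nhds.congr' ?_
    filter_upwards [hlim.eventually (gt_mem_nhds (sub_pos.2 (not_le.1 h)))] with k hk
    exact (ramp_of_ge (hδ k) (by linarith)).symm

theorem measurable_countingFun (Λ : Finset (Fin d → ℤ)) (E : ℝ) :
    Measurable fun ω => countingFun ω Λ E := by
  refine measurable_of_tendsto_metrizable
    (f := fun (n : ℕ) ω => boxMean ω Λ (ramp (1 / ((n : ℝ) + 1)) E))
    (fun n => measurable_boxMean (continuous_ramp _ _) Λ) (tendsto_pi_nhds.2 fun ω => ?_)
  rw [countingFun_eq_boxMean]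
  exact tendsto_boxMean ω Λ fun t => tendsto_ramp E t (fun k => by positivity)
    tendsto_one_div_add_atTop_nhds_zero_nat

theorem integrable_countingFun (μ : ProbabilityMeasure ℝ) (Λ : Finset (Fin d → ℤ)) (E : ℝ) :
    Integrable (fun ω => countingFun ω Λ E) (law d μ) :=
  Integrable.of_mem_Icc 0 1 (measurable_countingFun Λ E).aemeasurable
    (Filter.Eventually.of_forall fun ω => ⟨countingFun_nonneg ω Λ E, countingFun_le_one ω Λ E⟩)

/-! ### Mean counting functions of cubes -/

/-- The expected counting function of the cube of side `ℓ`. -/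
noncomputable def meanCount (d : ℕ) (μ : ProbabilityMeasure ℝ) (ℓ : ℕ) (E : ℝ) : ℝ :=
  ∫ ω, countingFun ω (cube 0 ℓ) E ∂(law d μ)

theorem integral_countingFun_cube (μ : ProbabilityMeasure ℝ) (a : Fin d → ℤ) (ℓ : ℕ) (E : ℝ) :
    ∫ ω, countingFun ω (cube a ℓ) E ∂(law d μ) = meanCount d μ ℓ E := by
  simp only [countingFun_cube _ a]
  rw [meanCount, ← (measurePreserving_translate μ a).map_eq,
    integral_map (measurePreserving_translate μ a).aemeasurable
      (measurable_countingFun _ _).aestronglyMeasurable, (measurePreserving_translate μ a).map_eq]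

theorem tendsto_meanCount (μ : ProbabilityMeasure ℝ) (ℓ : ℕ) (E : ℝ) {δ : ℕ → ℝ}
    (hδ : ∀ k, 0 < δ k) (hlim : Filter.Tendsto δ Filter.atTop (𝓝 0)) :
    Filter.Tendsto (fun k => meanCount d μ ℓ (E + δ k)) Filter.atTop (𝓝 (meanCount d μ ℓ E)) := by
  refine tendsto_integral_of_dominated_convergence (fun _ => 1)
    (fun k => (measurable_countingFun _ _).aestronglyMeasurable) (integrable_const 1)
    (fun k => Filter.Eventually.of_forall fun ω => ?_) (Filter.Eventually.of_forall fun ω => ?_)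
  · rw [Real.norm_of_nonneg (countingFun_nonneg _ _ _)]
    exact countingFun_le_one _ _ _
  · simp only [countingFun_eq_boxMean]
    refine tendsto_boxMean ω _ fun t => ?_
    by_cases h : t ≤ E
    · have : ∀ k, t ≤ E + δ k := fun k => h.trans (by linarith [hδ k])
      simp only [h, this, if_true]
      exact tendsto_const_nhds
    · rw [if_neg h]
      refine tendsto_const_nhds.congr' ?_
      filter_upwards [hlim.eventually (gt_mem_nhds (sub_pos.2 (not_le.1 h)))] with k hk
      rw [if_neg (by linarith)]

theorem integral_cellAverage (μ : ProbabilityMeasure ℝ) (a : Fin d → ℤ) (b : ℕ) {q : ℕ}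
    (hq : 0 < q) (E : ℝ) : ∫ ω, cellAverage ω a b q E ∂(law d μ) = meanCount d μ b E := by
  simp only [cellAverage]
  rw [integral_div, integral_finsetSum _ fun j _ => integrable_countingFun μ _ _]
  simp only [integral_countingFun_cube]
  simp
  field_simp

/-- The deterministic tiling estimate is integrated; by stationarity every cell has the same mean.
-/
theorem abs_meanCount_sub_le (μ : ProbabilityMeasure ℝ) {b ℓ : ℕ} (hb : 0 < b) (hℓ : b + 1 ≤ ℓ)
    (E : ℝ) : |meanCount d μ ℓ E - meanCount d μ b E| ≤
      d * (((b : ℝ) + 1) / ℓ + 1 / ((b : ℝ) + 1)) := by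
  have hq0 : 0 < ℓ / (b + 1) := Nat.div_pos hℓ (by omega)
  rw [← integral_cellAverage μ 0 b hq0, meanCount, ← integral_sub (integrable_countingFun μ _ _)]
  · have := norm_integral_le_of_norm_le_const (μ := law d μ)
      (f := fun ω => countingFun ω (cube 0 ℓ) E - cellAverage ω 0 b (ℓ / (b + 1)) E)
      (Filter.Eventually.of_forall fun ω => abs_countingFun_sub_cellAverage_le ω 0 hb hℓ E)
    simpa using this
  · exact (integrable_finsetSum _ fun j _ => integrable_countingFun μ _ _).div_const _

/-! ### Convergence to the integrated density of states -/

/-- Only sites closer than `i` to the boundary contribute. Their fraction is at most `2 d i / ℓ` by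
Bernoulli, and each contributes at most `2 (4 d + R) ^ i`. -/
theorem abs_sum_boxMatrix_pow_sub_le {ω : (Fin d → ℤ) → ℝ} {R : ℝ} (hR : ∀ k, |ω k| ≤ R)
    (i : ℕ) {ℓ : ℕ} (hℓ : 2 * i < ℓ) :
    |(∑ x : (cube 0 ℓ : Finset (Fin d → ℤ)), (((boxMatrix ω (cube 0 ℓ)) ^ i) x x).re) /
        (cube (0 : Fin d → ℤ) ℓ).card -
      (∑ x : (cube 0 ℓ : Finset (Fin d → ℤ)), (moment ω i x).re) /
        (cube (0 : Fin d → ℤ) ℓ).card| ≤ 4 * d * i * (4 * d + R) ^ i / ℓ := by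
  have hR0 : 0 ≤ R := (abs_nonneg _).trans (hR 0)
  set Λ : Finset (Fin d → ℤ) := cube 0 ℓ with hΛ
  set G : Finset (Fin d → ℤ) := cube (fun _ => (i : ℤ)) (ℓ - 2 * i) with hG
  have hGΛ : G ⊆ Λ := by
    intro x hx
    rw [mem_cube] at hx ⊢
    intro j
    have := hx j
    simp only [Pi.zero_apply]
    omega
  have hterm : ∀ x : Λ, |(((boxMatrix ω Λ) ^ i) x x).re - (moment ω i x).re| ≤
      if x.1 ∈ G then 0 else 2 * (4 * d + R) ^ i := by
    intro x
    split_ifs with hx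
    · rw [boxMatrix_pow_apply_eq_moment ω Λ i x, sub_self, abs_zero]
      intro y hy
      rw [hΛ, mem_cube]
      intro j
      have h1 := (mem_cube.1 hx) j
      have h2 := abs_le.1 (hy j)
      simp only [Pi.zero_apply]
      omega
    · have h1 := (Complex.abs_re_le_norm _).trans (norm_boxMatrix_pow_apply_le hR Λ i x)
      have h2 := (Complex.abs_re_le_norm _).trans (norm_formalOp_pow_le hR i x.1 x.1)
      have := abs_sub (((boxMatrix ω Λ) ^ i) x x).re (moment ω i x).re
      rw [moment] at *
      linarith
  have hsum : |∑ x : Λ, ((((boxMatrix ω Λ) ^ i) x x).re - (moment ω i x).re)| ≤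
      ((ℓ : ℝ) ^ d - ((ℓ : ℝ) - 2 * i) ^ d) * (2 * (4 * d + R) ^ i) := by
    refine (Finset.abs_sum_le_sum_abs _ _).trans ((Finset.sum_le_sum fun x _ => hterm x).trans ?_)
    rw [Finset.sum_coe_sort Λ (fun x => if x ∈ G then 0 else 2 * (4 * d + R) ^ i)]
    rw [Finset.sum_ite, Finset.sum_const_zero, zero_add, Finset.sum_const, nsmul_eq_mul]
    refine le_of_eq ?_
    congr 1
    have : (Λ.filter fun x => x ∉ G) = Λ \ G := by ext; simp
    rw [this, Finset.cast_card_sdiff hGΛ, hΛ, hG, card_cube, card_cube]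
    push_cast [hℓ.le]
    rfl
  have hℓ0 : (0 : ℝ) < ℓ := by exact_mod_cast (by omega : 0 < ℓ)
  rw [← sub_div, ← Finset.sum_sub_distrib, abs_div, Nat.abs_cast, hΛ, card_cube, Nat.cast_pow,
    ← hΛ]
  rw [div_le_div_iff₀ (by positivity) hℓ0]
  have hlt : (2 * i : ℝ) ≤ ℓ := by exact_mod_cast hℓ.le
  have hbern := one_add_mul_le_pow (a := -(2 * i / ℓ : ℝ))
    (by rw [neg_le_neg_iff]; exact ((div_le_one hℓ0).2 hlt).trans one_le_two) d
  have hb : (ℓ : ℝ) ^ d - ((ℓ : ℝ) - 2 * i) ^ d ≤ ℓ ^ d * (d * (2 * i / ℓ)) := by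
    have : ((ℓ : ℝ) - 2 * i) ^ d = ℓ ^ d * (1 + -(2 * i / ℓ)) ^ d := by
      rw [← mul_pow]; congr 1; field_simp; ring
    rw [this]
    have hp : (0 : ℝ) < ℓ ^ d := by positivity
    nlinarith
  have hR' : (0 : ℝ) ≤ 2 * (4 * d + R) ^ i := by positivity
  calc |∑ x : Λ, ((((boxMatrix ω Λ) ^ i) x x).re - (moment ω i x).re)| * ℓ
      ≤ (ℓ ^ d * (d * (2 * i / ℓ))) * (2 * (4 * d + R) ^ i) * ℓ := by
        gcongr
        exact hsum.trans (mul_le_mul_of_nonneg_right hb hR')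
    _ = 4 * d * i * (4 * d + R) ^ i * ℓ ^ d := by field_simp; ring

theorem integrable_of_ae_abs_le {Ω : Type*} [MeasurableSpace Ω] {P : Measure Ω}
    [IsProbabilityMeasure P] {f : Ω → ℝ} (hf : AEMeasurable f P) {c : ℝ}
    (h : ∀ᵐ ω ∂P, |f ω| ≤ c) : Integrable f P :=
  Integrable.of_bound hf.aestronglyMeasurable c h

theorem abs_moment_le {ω : (Fin d → ℤ) → ℝ} {R : ℝ} (hR : ∀ k, |ω k| ≤ R) (i : ℕ)
    (x : Fin d → ℤ) : |(moment ω i x).re| ≤ (4 * d + R) ^ i :=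
  (Complex.abs_re_le_norm _).trans (norm_formalOp_pow_le hR i x x)

theorem integrable_moment {μ : ProbabilityMeasure ℝ} {R : ℝ}
    (hR : ∀ᵐ ω ∂(law d μ), ∀ k, |ω k| ≤ R) (i : ℕ) (x : Fin d → ℤ) :
    Integrable (fun ω => (moment ω i x).re) (law d μ) :=
  integrable_of_ae_abs_le (measurable_moment i x).aemeasurable
    (hR.mono fun _ h => abs_moment_le h i x)

theorem integral_moment (μ : ProbabilityMeasure ℝ) (i : ℕ) (x : Fin d → ℤ) :
    ∫ ω, (moment ω i x).re ∂(law d μ) = ∫ ω, (moment ω i 0).re ∂(law d μ) := by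
  simp only [moment_eq_moment_zero _ i x]
  conv_rhs => rw [← (measurePreserving_translate μ x).map_eq,
    integral_map (measurePreserving_translate μ x).aemeasurable
      (measurable_moment _ _).aestronglyMeasurable]

theorem integrable_boxMatrix_pow {μ : ProbabilityMeasure ℝ} {R : ℝ}
    (hR : ∀ᵐ ω ∂(law d μ), ∀ k, |ω k| ≤ R) (i : ℕ) (Λ : Finset (Fin d → ℤ)) :
    Integrable (fun ω => (∑ x, (((boxMatrix ω Λ) ^ i) x x).re) / Λ.card) (law d μ) := by
  refine Integrable.div_const (integrable_finsetSum _ fun x _ => ?_) _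
  exact integrable_of_ae_abs_le (Complex.measurable_re.comp
    (measurable_boxMatrix_pow Λ i x x)).aemeasurable (hR.mono fun ω h =>
    (Complex.abs_re_le_norm _).trans (norm_boxMatrix_pow_apply_le h _ i x))

theorem tendsto_integral_boxMatrix_pow {μ : ProbabilityMeasure ℝ} {R : ℝ}
    (hR : ∀ᵐ ω ∂(law d μ), ∀ k, |ω k| ≤ R) (i : ℕ) :
    Filter.Tendsto (fun ℓ : ℕ => ∫ ω, (∑ x : (cube 0 ℓ : Finset (Fin d → ℤ)),
      (((boxMatrix ω (cube 0 ℓ)) ^ i) x x).re) / (cube (0 : Fin d → ℤ) ℓ).card ∂(law d μ))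
      Filter.atTop (𝓝 (∫ ω, (moment ω i 0).re ∂(law d μ))) := by
  rw [tendsto_iff_norm_sub_tendsto_zero]
  have hlim : Filter.Tendsto (fun ℓ : ℕ => 4 * d * i * (4 * d + R) ^ i / (ℓ : ℝ))
      Filter.atTop (𝓝 0) := tendsto_const_div_atTop_nhds_zero_nat _
  refine squeeze_zero' (Filter.Eventually.of_forall fun n => norm_nonneg _) ?_ hlim
  filter_upwards [Filter.eventually_gt_atTop (2 * i)] with ℓ hℓ
  have hcard : ((cube (0 : Fin d → ℤ) ℓ).card : ℝ) ≠ 0 := by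
    rw [card_cube]
    have : ℓ ≠ 0 := by omega
    positivity
  have hmean : ∫ ω, (moment ω i 0).re ∂(law d μ) =
      ∫ ω, (∑ x : (cube 0 ℓ : Finset (Fin d → ℤ)), (moment ω i x).re) /
        (cube (0 : Fin d → ℤ) ℓ).card ∂(law d μ) := by
    rw [integral_div, integral_finsetSum _ (f := fun (x : (cube 0 ℓ : Finset (Fin d → ℤ))) ω =>
      (moment ω i x.1).re) fun x _ => integrable_moment hR i x.1]
    simp only [integral_moment]
    simp [hcard]
  rw [hmean, ← integral_sub]
  · refine (norm_integral_le_of_norm_le_const (μ := law d μ)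
      (hR.mono fun ω h => abs_sum_boxMatrix_pow_sub_le h i hℓ)).trans ?_
    simp
  · exact integrable_boxMatrix_pow hR i (cube 0 ℓ)
  · exact (integrable_finsetSum _ fun x _ => integrable_moment hR i x.1).div_const _

/-- The unit vector `δ_0`. -/
noncomputable def delta (d : ℕ) : Ell2 d := lp.single 2 0 (1 : ℂ)

theorem norm_delta (d : ℕ) : ‖delta d‖ = 1 := by
  rw [delta, lp.norm_single (by norm_num)]
  simp

theorem tendsto_integral_boxMean_polynomial {μ : ProbabilityMeasure ℝ} {R : ℝ}
    (hR : ∀ᵐ ω ∂(law d μ), ∀ k, |ω k| ≤ R) (p : Polynomial ℝ) :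
    Filter.Tendsto (fun ℓ : ℕ => ∫ ω, boxMean ω (cube 0 ℓ) (fun t => p.eval t) ∂(law d μ))
      Filter.atTop (𝓝 (∫ ω, specForm (op ω) (delta d) (fun t => p.eval t) ∂(law d μ))) := by
  have h1 : ∫ ω, specForm (op ω) (delta d) (fun t => p.eval t) ∂(law d μ) =
      ∑ i ∈ Finset.range (p.natDegree + 1), p.coeff i * ∫ ω, (moment ω i 0).re ∂(law d μ) := by
    have hsp : ∀ᵐ ω ∂(law d μ), specForm (op ω) (delta d) (fun t => p.eval t) =
        ∑ i ∈ Finset.range (p.natDegree + 1), p.coeff i * (moment ω i 0).re :=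
      hR.mono fun ω h => specForm_polynomial h p 0
    rw [integral_congr_ae hsp,
      integral_finsetSum _ fun i _ => (integrable_moment hR i 0).const_mul _]
    simp only [integral_const_mul]
  have h2 : ∀ ℓ : ℕ, ∫ ω, boxMean ω (cube 0 ℓ) (fun t => p.eval t) ∂(law d μ) =
      ∑ i ∈ Finset.range (p.natDegree + 1), p.coeff i *
        ∫ ω, (∑ x : (cube 0 ℓ : Finset (Fin d → ℤ)),
          (((boxMatrix ω (cube 0 ℓ)) ^ i) x x).re) / (cube (0 : Fin d → ℤ) ℓ).card ∂(law d μ) := by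
    intro ℓ
    simp only [boxMean, sum_eigenvalues_polynomial, Finset.sum_div, mul_div_assoc]
    rw [integral_finsetSum]
    · simp only [integral_const_mul]
    · intro i _
      simpa only [Finset.sum_div] using
        (integrable_boxMatrix_pow hR i (cube 0 ℓ)).const_mul (p.coeff i)
  simp only [h1, h2]
  exact tendsto_finsetSum _ fun i _ => (tendsto_integral_boxMatrix_pow hR i).const_mul _

/-- For polynomials the form is a combination of measurable moments; the approximating polynomials
converge uniformly on the almost surely bounded spectrum. -/
theorem aemeasurable_specForm {μ : ProbabilityMeasure ℝ} {R : ℝ}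
    (hR : ∀ᵐ ω ∂(law d μ), ∀ k, |ω k| ≤ R) {f : ℝ → ℝ} (hf : Continuous f) :
    AEMeasurable (fun ω => specForm (op ω) (delta d) f) (law d μ) := by
  obtain ⟨p, hp⟩ := exists_polynomial_seq hf
  refine aemeasurable_of_tendsto_metrizable_ae Filter.atTop (f := fun n ω =>
    ∑ i ∈ Finset.range ((p n).natDegree + 1), (p n).coeff i * (moment ω i 0).re) (fun n => ?_) ?_
  · exact (Finset.measurable_sum _ fun i _ => (measurable_moment i 0).const_mul _).aemeasurable
  · filter_upwards [hR] with ω hω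
    simp only [← specForm_polynomial hω _ 0]
    rw [tendsto_iff_norm_sub_tendsto_zero]
    refine squeeze_zero' (Filter.Eventually.of_forall fun n => norm_nonneg _) ?_
      tendsto_one_div_add_atTop_nhds_zero_nat
    obtain ⟨N, hN⟩ := exists_nat_ge (4 * d + R)
    filter_upwards [Filter.eventually_ge_atTop N] with n hn
    refine abs_specForm_sub_le (isSelfAdjoint_op hω).1 (norm_delta d)
      (p n).continuous hf fun t ht => (hp t).2 n ?_
    exact (abs_le_of_mem_spectrum_op hω ht).trans (hN.trans (by exact_mod_cast hn))

theorem abs_specForm_le {ω : (Fin d → ℤ) → ℝ} {R : ℝ} (hR : ∀ k, |ω k| ≤ R) {f : ℝ → ℝ}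
    (hf : Continuous f) {c : ℝ} (h : ∀ t, |t| ≤ 4 * d + R → |f t| ≤ c) :
    |specForm (op ω) (delta d) f| ≤ c := by
  have h0 : specForm (op ω) (delta d) (fun _ => 0) = 0 := by simp [specForm]
  have := abs_specForm_sub_le (isSelfAdjoint_op hR).1 (norm_delta d) hf
    (continuous_const (y := (0 : ℝ))) (η := c) fun t ht => by
      simpa using h t (abs_le_of_mem_spectrum_op hR ht)
  rwa [h0, sub_zero] at this

theorem exists_abs_le_of_continuous {f : ℝ → ℝ} (hf : Continuous f) (r : ℝ) :
    ∃ c, 0 ≤ c ∧ ∀ t, |t| ≤ r → |f t| ≤ c := by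
  obtain ⟨c, hc⟩ := (isCompact_Icc (a := -r) (b := r)).exists_bound_of_continuousOn hf.continuousOn
  exact ⟨max c 0, le_max_right _ _, fun t ht => (hc t (abs_le.1 ht)).trans (le_max_left _ _)⟩

theorem integrable_specForm {μ : ProbabilityMeasure ℝ} {R : ℝ}
    (hR : ∀ᵐ ω ∂(law d μ), ∀ k, |ω k| ≤ R) {f : ℝ → ℝ} (hf : Continuous f) :
    Integrable (fun ω => specForm (op ω) (delta d) f) (law d μ) := by
  obtain ⟨c, -, hc⟩ := exists_abs_le_of_continuous hf (4 * d + R)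
  exact integrable_of_ae_abs_le (aemeasurable_specForm hR hf)
    (hR.mono fun ω h => abs_specForm_le h hf hc)

theorem integrable_boxMean {μ : ProbabilityMeasure ℝ} {R : ℝ}
    (hR : ∀ᵐ ω ∂(law d μ), ∀ k, |ω k| ≤ R) {f : ℝ → ℝ} (hf : Continuous f)
    (Λ : Finset (Fin d → ℤ)) : Integrable (fun ω => boxMean ω Λ f) (law d μ) := by
  obtain ⟨c, hc0, hc⟩ := exists_abs_le_of_continuous hf (4 * d + R)
  refine integrable_of_ae_abs_le (measurable_boxMean hf Λ).aemeasurable (c := c)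
    (hR.mono fun ω h => ?_)
  have := abs_boxMean_sub_le ω (Λ := Λ) (f := f) (g := fun _ => 0) hc0 fun j => by
    simpa using hc _ (abs_eigenvalues_boxMatrix_le h Λ j)
  simpa [boxMean] using this

theorem abs_integral_sub_le {Ω : Type*} [MeasurableSpace Ω] {P : Measure Ω}
    [IsProbabilityMeasure P] {f g : Ω → ℝ} (hf : Integrable f P) (hg : Integrable g P) {c : ℝ}
    (h : ∀ᵐ ω ∂P, |f ω - g ω| ≤ c) : |∫ ω, f ω ∂P - ∫ ω, g ω ∂P| ≤ c := by
  rw [← integral_sub hf hg]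
  refine (norm_integral_le_of_norm_le_const (f := fun ω => f ω - g ω) h).trans ?_
  simp

/-- Convergence of the density of states against continuous functions. -/
theorem tendsto_integral_boxMean {μ : ProbabilityMeasure ℝ} {R : ℝ}
    (hR : ∀ᵐ ω ∂(law d μ), ∀ k, |ω k| ≤ R) {f : ℝ → ℝ} (hf : Continuous f) :
    Filter.Tendsto (fun ℓ : ℕ => ∫ ω, boxMean ω (cube 0 ℓ) f ∂(law d μ))
      Filter.atTop (𝓝 (∫ ω, specForm (op ω) (delta d) f ∂(law d μ))) := by
  rw [Metric.tendsto_atTop]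
  intro ε hε
  obtain ⟨p, hp⟩ := exists_polynomial_near_of_continuousOn (-(4 * d + R)) (4 * d + R) f
    hf.continuousOn (ε / 3) (by positivity)
  obtain ⟨N, hN⟩ := Metric.tendsto_atTop.1 (tendsto_integral_boxMean_polynomial hR p) (ε / 3)
    (by positivity)
  refine ⟨N, fun ℓ hℓ => ?_⟩
  have h1 := hN ℓ hℓ
  have h2 := abs_integral_sub_le (integrable_boxMean hR p.continuous (cube 0 ℓ))
    (integrable_boxMean hR hf (cube 0 ℓ)) (c := ε / 3) (hR.mono fun ω h =>
      abs_boxMean_sub_le ω (by positivity) fun j =>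
        (hp _ (abs_le.1 (abs_eigenvalues_boxMatrix_le h _ j))).le)
  have h3 := abs_integral_sub_le (integrable_specForm hR p.continuous)
    (integrable_specForm hR hf) (c := ε / 3) (hR.mono fun ω h =>
      abs_specForm_sub_le (isSelfAdjoint_op h).1 (norm_delta d) p.continuous hf fun t ht =>
        (hp _ (abs_le.1 (abs_le_of_mem_spectrum_op h ht))).le)
  rw [Real.dist_eq] at h1 ⊢
  rw [abs_lt] at h1 ⊢
  rw [abs_le] at h2 h3
  constructor <;> linarith [h1.1, h1.2, h2.1, h2.2, h3.1, h3.2]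

theorem box_one (d : ℕ) : box d 1 = {0} := by
  have h1 : ⌈-(1 / 2 : ℝ)⌉ = 0 := by rw [Int.ceil_eq_iff]; norm_num
  have h2 : ⌈(1 / 2 : ℝ)⌉ = 1 := by rw [Int.ceil_eq_iff]; norm_num
  ext x
  rw [box, h1, h2, Fintype.mem_piFinset, Finset.mem_singleton, funext_iff]
  refine forall_congr' fun i => ?_
  simp only [Finset.mem_Ico, Pi.zero_apply]
  omega

theorem ids_eq (μ : ProbabilityMeasure ℝ) (E : ℝ) :
    ids d μ E = ∫ ω, (inner ℂ (delta d) (spectralProj (op ω) E (delta d))).re ∂(law d μ) := by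
  simp only [ids, box_one, Finset.sum_singleton, delta]

theorem tendsto_integral_specForm_ramp {μ : ProbabilityMeasure ℝ} {R : ℝ}
    (hR : ∀ᵐ ω ∂(law d μ), ∀ k, |ω k| ≤ R) (E : ℝ) {δ : ℕ → ℝ} (hδ : ∀ k, 0 < δ k)
    (hlim : Filter.Tendsto δ Filter.atTop (𝓝 0)) :
    Filter.Tendsto (fun k => ∫ ω, specForm (op ω) (delta d) (ramp (δ k) E) ∂(law d μ))
      Filter.atTop (𝓝 (ids d μ E)) := by
  rw [ids_eq]
  refine tendsto_integral_of_dominated_convergence (fun _ => 1)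
    (fun k => (aemeasurable_specForm hR (continuous_ramp _ _)).aestronglyMeasurable)
    (integrable_const 1) (fun k => hR.mono fun ω h => ?_) (hR.mono fun ω h => ?_)
  · refine abs_specForm_le h (continuous_ramp _ _) fun t _ => ?_
    rw [abs_of_nonneg (ramp_nonneg _ _ _)]
    exact ramp_le_one (hδ k) E t
  · exact tendsto_specForm_ramp (isSelfAdjoint_op h).1 E hδ hlim _

theorem tendsto_meanCount_error (d b : ℕ) : Filter.Tendsto
    (fun ℓ : ℕ => (d : ℝ) * (((b : ℝ) + 1) / ℓ + 1 / ((b : ℝ) + 1))) Filter.atTop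
    (𝓝 (d / ((b : ℝ) + 1))) := by
  have h := ((tendsto_const_div_atTop_nhds_zero_nat ((b : ℝ) + 1)).add_const
    (1 / ((b : ℝ) + 1))).const_mul (d : ℝ)
  simpa [div_eq_mul_inv] using h

/-- The ramp lies between the indicators of `(-∞, E]` and `(-∞, E + δ]`. In a cube of side `ℓ` both
are counted and compared with side `b`; then `ℓ → ∞` with `b` fixed. -/
theorem meanCount_sub_le_integral_specForm {μ : ProbabilityMeasure ℝ} {R : ℝ}
    (hR : ∀ᵐ ω ∂(law d μ), ∀ k, |ω k| ≤ R) {b : ℕ} (hb : 0 < b) {δ : ℝ} (hδ : 0 < δ) (E : ℝ) :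
    meanCount d μ b E - d / ((b : ℝ) + 1) ≤ ∫ ω, specForm (op ω) (delta d) (ramp δ E) ∂(law d μ) ∧
      ∫ ω, specForm (op ω) (delta d) (ramp δ E) ∂(law d μ) ≤
        meanCount d μ b (E + δ) + d / ((b : ℝ) + 1) := by
  have hlim := tendsto_integral_boxMean hR (continuous_ramp δ E)
  have herr := tendsto_meanCount_error d b
  have hint := fun ℓ => integrable_boxMean hR (continuous_ramp δ E) (cube 0 ℓ)
  constructor
  · refine le_of_tendsto_of_tendsto (herr.const_sub _) hlim ?_
    filter_upwards [Filter.eventually_ge_atTop (b + 1)] with ℓ hℓ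
    have h1 := (abs_le.1 (abs_meanCount_sub_le (d := d) μ hb hℓ E)).1
    have h2 : meanCount d μ ℓ E ≤ ∫ ω, boxMean ω (cube 0 ℓ) (ramp δ E) ∂(law d μ) :=
      integral_mono (integrable_countingFun μ _ _) (hint ℓ)
        fun ω => countingFun_le_boxMean_ramp ω _ δ E
    linarith
  · refine le_of_tendsto_of_tendsto hlim (herr.const_add _) ?_
    filter_upwards [Filter.eventually_ge_atTop (b + 1)] with ℓ hℓ
    have h1 := (abs_le.1 (abs_meanCount_sub_le (d := d) μ hb hℓ (E + δ))).2
    have h2 : ∫ ω, boxMean ω (cube 0 ℓ) (ramp δ E) ∂(law d μ) ≤ meanCount d μ ℓ (E + δ) :=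
      integral_mono (hint ℓ) (integrable_countingFun μ _ _)
        fun ω => boxMean_ramp_le_countingFun ω _ hδ E
    linarith

/-- The integrated density of states is uniformly close to the mean counting function of a cube. -/
theorem abs_ids_sub_meanCount_le {μ : ProbabilityMeasure ℝ} {R : ℝ}
    (hR : ∀ᵐ ω ∂(law d μ), ∀ k, |ω k| ≤ R) {b : ℕ} (hb : 0 < b) (E : ℝ) :
    |ids d μ E - meanCount d μ b E| ≤ d / ((b : ℝ) + 1) := by
  have hδ : ∀ k : ℕ, (0 : ℝ) < 1 / ((k : ℝ) + 1) := fun k => by positivity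
  have hδ0 := tendsto_one_div_add_atTop_nhds_zero_nat (𝕜 := ℝ)
  have h1 := tendsto_integral_specForm_ramp hR E hδ hδ0
  have h2 := tendsto_meanCount (d := d) μ b E hδ hδ0
  have h3 := ge_of_tendsto' h1 fun k => (meanCount_sub_le_integral_specForm hR hb (hδ k) E).1
  -- As `δ → 0` the upper bound needs the right-continuity of `meanCount`.
  have h4 := le_of_tendsto_of_tendsto' h1 (h2.add_const _) fun k =>
    (meanCount_sub_le_integral_specForm hR hb (hδ k) E).2
  rw [abs_le]
  constructor <;> linarith

theorem ids_mono {μ : ProbabilityMeasure ℝ} {R : ℝ}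
    (hR : ∀ᵐ ω ∂(law d μ), ∀ k, |ω k| ≤ R) : Monotone (ids d μ) := by
  intro E E' h
  have hδ : ∀ k : ℕ, (0 : ℝ) < 1 / ((k : ℝ) + 1) := fun k => by positivity
  have hδ0 := tendsto_one_div_add_atTop_nhds_zero_nat (𝕜 := ℝ)
  refine le_of_tendsto_of_tendsto' (tendsto_integral_specForm_ramp hR E hδ hδ0)
    (tendsto_integral_specForm_ramp hR E' hδ hδ0) fun k => ?_
  exact integral_mono (integrable_specForm hR (continuous_ramp _ _))
    (integrable_specForm hR (continuous_ramp _ _)) fun ω =>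
      specForm_mono _ (continuous_ramp _ _) (continuous_ramp _ _) fun t _ => ramp_mono (hδ k) t h

theorem ids_le_integral_specForm {μ : ProbabilityMeasure ℝ} {R : ℝ}
    (hR : ∀ᵐ ω ∂(law d μ), ∀ k, |ω k| ≤ R) {δ : ℝ} (hδ : 0 < δ) (E : ℝ) :
    ids d μ E ≤ ∫ ω, specForm (op ω) (delta d) (ramp δ E) ∂(law d μ) := by
  have hδ' : ∀ k : ℕ, (0 : ℝ) < δ / ((k : ℝ) + 1) := fun k => by positivity
  have hδ0 : Filter.Tendsto (fun k : ℕ => δ / ((k : ℝ) + 1)) Filter.atTop (𝓝 0) := by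
    simpa [div_eq_mul_inv] using tendsto_one_div_add_atTop_nhds_zero_nat (𝕜 := ℝ).const_mul δ
  refine le_of_tendsto' (tendsto_integral_specForm_ramp hR E hδ' hδ0) fun k => ?_
  refine integral_mono (integrable_specForm hR (continuous_ramp _ _))
    (integrable_specForm hR (continuous_ramp _ _)) fun ω =>
      specForm_mono _ (continuous_ramp _ _) (continuous_ramp _ _) fun t _ => ?_
  have : δ / ((k : ℝ) + 1) ≤ δ := div_le_self hδ.le (by linarith [(Nat.cast_nonneg k : (0:ℝ) ≤ k)])
  unfold ramp
  gcongr

/-- Above `E`, the density of states is dominated by the form of a fixed ramp, which is Lipschitz in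
the energy and at `E` within `ε / 2` of the limit. -/
theorem continuousWithinAt_ids {μ : ProbabilityMeasure ℝ} {R : ℝ}
    (hR : ∀ᵐ ω ∂(law d μ), ∀ k, |ω k| ≤ R) (E : ℝ) :
    ContinuousWithinAt (ids d μ) (Set.Ici E) E := by
  have hδ : ∀ k : ℕ, (0 : ℝ) < 1 / ((k : ℝ) + 1) := fun k => by positivity
  have hδ0 := tendsto_one_div_add_atTop_nhds_zero_nat (𝕜 := ℝ)
  have h1 := tendsto_integral_specForm_ramp hR E hδ hδ0
  rw [Metric.continuousWithinAt_iff]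
  intro ε hε
  obtain ⟨k, hk⟩ := (h1.eventually (gt_mem_nhds (show ids d μ E < ids d μ E + ε / 2 by
    linarith))).exists
  refine ⟨1 / ((k : ℝ) + 1) * (ε / 2), by have := hδ k; positivity, fun {E'} hE' hdist => ?_⟩
  have hle : E ≤ E' := hE'
  rw [Real.dist_eq, abs_of_nonneg (sub_nonneg.2 hle)] at hdist
  rw [Real.dist_eq, abs_of_nonneg (sub_nonneg.2 (ids_mono hR hle))]
  have h2 := ids_le_integral_specForm hR (hδ k) E'
  have h3 : ∫ ω, specForm (op ω) (delta d) (ramp (1 / ((k : ℝ) + 1)) E') ∂(law d μ) ≤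
      ∫ ω, (specForm (op ω) (delta d) (ramp (1 / ((k : ℝ) + 1)) E) +
        (E' - E) / (1 / ((k : ℝ) + 1))) ∂(law d μ) := by
    refine integral_mono_ae (integrable_specForm hR (continuous_ramp _ _))
      ((integrable_specForm hR (continuous_ramp _ _)).add (integrable_const _))
      (hR.mono fun ω h => ?_)
    have e := specForm_add_const (isSelfAdjoint_op h).1 (delta d)
      (continuous_ramp (1 / ((k : ℝ) + 1)) E) ((E' - E) / (1 / ((k : ℝ) + 1)))
    rw [norm_delta, one_pow, mul_one] at e
    refine le_trans ?_ e.le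
    exact specForm_mono _ (continuous_ramp _ _) ((continuous_ramp _ _).add_const _)
      fun t _ => ramp_le_ramp_add (hδ k) hle t
  rw [integral_add (integrable_specForm hR (continuous_ramp _ _)) (integrable_const _)] at h3
  simp only [integral_const, probReal_univ, one_smul] at h3
  have h4 : (E' - E) / (1 / ((k : ℝ) + 1)) < ε / 2 := by
    rw [div_lt_iff₀ (hδ k), mul_comm]
    exact hdist
  linarith

theorem ids_mem_Icc {μ : ProbabilityMeasure ℝ} {R : ℝ}
    (hR : ∀ᵐ ω ∂(law d μ), ∀ k, |ω k| ≤ R) (E : ℝ) : ids d μ E ∈ Set.Icc 0 1 := by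
  have hδ : ∀ k : ℕ, (0 : ℝ) < 1 / ((k : ℝ) + 1) := fun k => by positivity
  have h1 := tendsto_integral_specForm_ramp hR E hδ tendsto_one_div_add_atTop_nhds_zero_nat
  have hI := fun k : ℕ => integrable_specForm hR (continuous_ramp (1 / ((k : ℝ) + 1)) E)
  constructor
  · refine ge_of_tendsto' h1 fun k => integral_nonneg fun ω => ?_
    have := specForm_mono (A := op ω) (delta d) (continuous_const (y := (0 : ℝ)))
      (continuous_ramp (1 / ((k : ℝ) + 1)) E) fun t _ => ramp_nonneg _ _ t
    simpa [specForm] using this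
  · refine le_of_tendsto' h1 fun k => ?_
    refine (integral_mono_ae (hI k) (integrable_const (1 : ℝ)) (hR.mono fun ω h => ?_)).trans ?_
    · refine (le_abs_self _).trans (abs_specForm_le h (continuous_ramp _ _) fun t _ => ?_)
      rw [abs_of_nonneg (ramp_nonneg _ _ _)]
      exact ramp_le_one (hδ k) E t
    · simp

/-! ### Uniform deviations of averages of monotone functions -/

section Uniform

variable {Ω : Type*} [MeasurableSpace Ω] {P : Measure Ω}

theorem exists_countable_cofinal (S : Set ℝ) :
    ∃ T ⊆ S, T.Countable ∧ ∀ E ∈ S, ∃ E' ∈ T, E ≤ E' := by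
  by_cases hmax : ∃ M ∈ S, ∀ E ∈ S, E ≤ M
  · obtain ⟨M, hM, h⟩ := hmax
    exact ⟨{M}, by simpa using hM, Set.countable_singleton M, fun E hE => ⟨M, rfl, h E hE⟩⟩
  · push Not at hmax
    obtain ⟨D, hDc, hD⟩ := TopologicalSpace.exists_countable_dense S
    refine ⟨Subtype.val '' D, by rintro _ ⟨x, -, rfl⟩; exact x.2, hDc.image _, fun E hE => ?_⟩
    obtain ⟨E', hE', hlt⟩ := hmax E hE
    obtain ⟨y, hy, hyD⟩ := hD.inter_open_nonempty {x : S | E < x.1}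
      (isOpen_lt continuous_const continuous_subtype_val) ⟨⟨E', hE'⟩, hlt⟩
    exact ⟨y.1, ⟨y, hyD, rfl⟩, le_of_lt hy⟩

/-- A countable cofinal subset makes this a directed union, whose measure is a supremum. Uncountably
many energies therefore cost no more than one. -/
theorem measure_biUnion_le_of_monotone {A : ℝ → Set Ω} (hA : Monotone A) (S : Set ℝ) {c : ℝ≥0∞}
    (h : ∀ E ∈ S, P (A E) ≤ c) : P (⋃ E ∈ S, A E) ≤ c := by
  obtain ⟨T, hTS, hT, hcof⟩ := exists_countable_cofinal S
  have h1 : (⋃ E ∈ S, A E) ⊆ ⋃ E ∈ T, A E := by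
    intro ω hω
    simp only [mem_iUnion] at hω ⊢
    obtain ⟨E, hE, hω⟩ := hω
    obtain ⟨E', hE', hle⟩ := hcof E hE
    exact ⟨E', hE', hA hle hω⟩
  refine (measure_mono h1).trans ?_
  rw [measure_biUnion_eq_iSup hT]
  · exact iSup₂_le fun E hE => h E (hTS hE)
  · intro E hE E' hE'
    rcases le_total E E' with hle | hle
    · exact ⟨E', hE', hA hle, subset_rfl⟩
    · exact ⟨E, hE, subset_rfl, hA hle⟩

theorem measure_biUnion_le_of_antitone {A : ℝ → Set Ω} (hA : Antitone A) (S : Set ℝ) {c : ℝ≥0∞}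
    (h : ∀ E ∈ S, P (A E) ≤ c) : P (⋃ E ∈ S, A E) ≤ c := by
  have h1 := measure_biUnion_le_of_monotone (P := P) (A := fun E => A (-E))
    (fun _ _ h => hA (neg_le_neg h)) (-S) (c := c) fun E hE => h (-E) hE
  refine (measure_mono ?_).trans h1
  intro ω hω
  simp only [mem_iUnion] at hω ⊢
  obtain ⟨E, hE, hω⟩ := hω
  exact ⟨-E, by simpa using hE, by simpa using hω⟩

variable [IsProbabilityMeasure P] {J : Type*} [Fintype J]

/-- Hoeffding's inequality for an average of independent variables with values in `[0, 1]`. -/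
theorem measure_average_ge_le [Nonempty J] {X : J → Ω → ℝ} (hX : ∀ j, Measurable (X j))
    (hX01 : ∀ j ω, X j ω ∈ Set.Icc (0 : ℝ) 1) (hind : ProbabilityTheory.iIndepFun X P) {m : ℝ}
    (hm : ∀ j, ∫ ω, X j ω ∂P = m) {t : ℝ} (ht : 0 ≤ t) :
    P {ω | m + t ≤ (∑ j, X j ω) / Fintype.card J} ≤
      ENNReal.ofReal (Real.exp (-2 * Fintype.card J * t ^ 2)) := by
  have hN : (0 : ℝ) < Fintype.card J := by exact_mod_cast Fintype.card_pos
  -- Values in an interval of length one give variance proxy `1 / 4`, hence the factor `2` in the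
  -- exponent.
  have hsub : ∀ j ∈ (Finset.univ : Finset J), ProbabilityTheory.HasSubgaussianMGF
      (fun ω => X j ω - m) ((‖(1 : ℝ) - 0‖₊ / 2) ^ 2) P := by
    intro j _
    have := ProbabilityTheory.hasSubgaussianMGF_of_mem_Icc (μ := P) (hX j).aemeasurable
      (Filter.Eventually.of_forall (hX01 j))
    rwa [hm j] at this
  have hind' : ProbabilityTheory.iIndepFun (fun j ω => X j ω - m) P :=
    hind.comp (fun _ x => x - m) fun _ => by fun_prop
  have h := ProbabilityTheory.HasSubgaussianMGF.measure_sum_ge_le_of_iIndepFun hind' hsub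
    (ε := Fintype.card J * t) (by positivity)
  have hset : {ω | m + t ≤ (∑ j, X j ω) / Fintype.card J} =
      {ω | Fintype.card J * t ≤ ∑ j, (X j ω - m)} := by
    ext ω
    simp only [mem_ofPred_eq, Finset.sum_sub_distrib, Finset.sum_const, Finset.card_univ,
      nsmul_eq_mul]
    rw [le_div_iff₀ hN]
    constructor <;> intro h <;> linarith
  rw [hset, ← ofReal_measureReal]
  refine ENNReal.ofReal_le_ofReal (h.trans (le_of_eq ?_))
  congr 1
  simp
  field_simp

theorem measure_average_le_le [Nonempty J] {X : J → Ω → ℝ} (hX : ∀ j, Measurable (X j))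
    (hX01 : ∀ j ω, X j ω ∈ Set.Icc (0 : ℝ) 1) (hind : ProbabilityTheory.iIndepFun X P) {m : ℝ}
    (hm : ∀ j, ∫ ω, X j ω ∂P = m) {t : ℝ} (ht : 0 ≤ t) :
    P {ω | (∑ j, X j ω) / Fintype.card J ≤ m - t} ≤
      ENNReal.ofReal (Real.exp (-2 * Fintype.card J * t ^ 2)) := by
  have hN : (Fintype.card J : ℝ) ≠ 0 := by exact_mod_cast Fintype.card_ne_zero
  have h := measure_average_ge_le (P := P) (X := fun j ω => 1 - X j ω) (m := 1 - m)
    (fun j => measurable_const.sub (hX j))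
    (fun j ω => ⟨by linarith [(hX01 j ω).2], by linarith [(hX01 j ω).1]⟩)
    (hind.comp (fun _ x => 1 - x) fun _ => by fun_prop) (fun j => by
      rw [integral_sub (integrable_const _)
        (Integrable.of_mem_Icc 0 1 (hX j).aemeasurable (Filter.Eventually.of_forall (hX01 j))), hm]
      simp) ht
  refine (measure_mono fun ω hω => ?_).trans h
  simp only [mem_ofPred_eq, Finset.sum_sub_distrib, Finset.sum_const, Finset.card_univ,
    nsmul_eq_mul, sub_div, mul_one] at hω ⊢
  rw [div_self hN]
  linarith

/-- Uniform deviation bound for an average of independent monotone functions with values in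
`[0, 1]` and common mean `F`. -/
theorem measure_exists_deviation_le [Nonempty J] {X : J → ℝ → Ω → ℝ}
    (hX : ∀ j E, Measurable (X j E)) (hX01 : ∀ j E ω, X j E ω ∈ Set.Icc (0 : ℝ) 1)
    (hmono : ∀ j ω, Monotone fun E => X j E ω)
    (hind : ∀ E, ProbabilityTheory.iIndepFun (fun j => X j E) P) {F : ℝ → ℝ}
    (hF : ∀ j E, ∫ ω, X j E ω ∂P = F E) {N : ℕ} (hN : 0 < N) {t : ℝ} (ht : 0 ≤ t) :
    P {ω | ∃ E, 1 / N + t < |(∑ j, X j E ω) / Fintype.card J - F E|} ≤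
      ENNReal.ofReal (2 * (N + 1) * Real.exp (-2 * Fintype.card J * t ^ 2)) := by
  set avg : ℝ → Ω → ℝ := fun E ω => (∑ j, X j E ω) / Fintype.card J with havg
  set p := ENNReal.ofReal (Real.exp (-2 * Fintype.card J * t ^ 2)) with hp
  have havgm : ∀ ω, Monotone fun E => avg E ω := fun ω E E' h => by
    simp only [havg]
    gcongr with j
    exact hmono j ω h
  -- For fixed `c` the events increase with `E`, and each with `F E ≤ c` obeys Hoeffding's bound, so
  -- the bound survives the union.
  have hup : ∀ c : ℝ, P (⋃ E ∈ {E | F E ≤ c}, {ω | c + t ≤ avg E ω}) ≤ p := by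
    intro c
    refine measure_biUnion_le_of_monotone (fun E E' h ω hω => hω.trans (havgm ω h)) _ ?_
    intro E hE
    refine (measure_mono fun ω hω => ?_).trans (measure_average_ge_le (fun j => hX j E)
      (fun j => hX01 j E) (hind E) (fun j => hF j E) ht)
    have h1 : F E ≤ c := hE
    have h2 : c + t ≤ avg E ω := hω
    exact le_trans (by linarith) h2
  have hlow : ∀ c : ℝ, P (⋃ E ∈ {E | c ≤ F E}, {ω | avg E ω ≤ c - t}) ≤ p := by
    intro c
    refine measure_biUnion_le_of_antitone (fun E E' h ω hω => (havgm ω h).trans hω) _ ?_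
    intro E hE
    refine (measure_mono fun ω hω => ?_).trans (measure_average_le_le (fun j => hX j E)
      (fun j => hX01 j E) (hind E) (fun j => hF j E) ht)
    have h1 : c ≤ F E := hE
    have h2 : avg E ω ≤ c - t := hω
    exact h2.trans (by linarith)
  have hN0 : (0 : ℝ) < N := by exact_mod_cast hN
  have hF01 : ∀ E, F E ∈ Set.Icc (0 : ℝ) 1 := by
    intro E
    obtain ⟨j⟩ := ‹Nonempty J›
    have hint := Integrable.of_mem_Icc 0 1 (hX j E).aemeasurable
      (μ := P) (Filter.Eventually.of_forall (hX01 j E))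
    rw [← hF j E]
    refine ⟨integral_nonneg fun ω => (hX01 j E ω).1, ?_⟩
    simpa using integral_mono hint (integrable_const (1 : ℝ)) fun ω => (hX01 j E ω).2
  -- Rounding `F E` up or down to a multiple of `1 / N` costs at most `1 / N`; there are `N + 1`
  -- levels and two directions.
  have hcover : {ω | ∃ E, 1 / N + t < |avg E ω - F E|} ⊆
      ⋃ k ∈ Finset.range (N + 1),
        ((⋃ E ∈ {E | F E ≤ (k : ℝ) / N}, {ω | (k : ℝ) / N + t ≤ avg E ω}) ∪
          (⋃ E ∈ {E | (k : ℝ) / N ≤ F E}, {ω | avg E ω ≤ (k : ℝ) / N - t})) := by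
    rintro ω ⟨E, hE⟩
    obtain ⟨h0, h1⟩ := hF01 E
    have hFN : 0 ≤ F E * N := by positivity
    have hFN1 : F E * N ≤ N := mul_le_of_le_one_left hN0.le h1
    simp only [mem_iUnion, mem_union, mem_ofPred_eq, Finset.mem_range]
    rcases lt_abs.1 hE with h | h
    · refine ⟨⌈F E * N⌉₊, Nat.lt_succ_of_le (Nat.ceil_le.2 hFN1), Or.inl ⟨E, ?_, ?_⟩⟩
      · rw [le_div_iff₀ hN0]; exact Nat.le_ceil _
      · have h2 : (⌈F E * N⌉₊ : ℝ) / N ≤ F E + 1 / N := by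
          rw [div_le_iff₀ hN0, add_mul, one_div_mul_cancel hN0.ne']
          exact (Nat.ceil_lt_add_one hFN).le
        linarith
    · refine ⟨⌊F E * N⌋₊, Nat.lt_succ_of_le (Nat.floor_le_of_le hFN1), Or.inr ⟨E, ?_, ?_⟩⟩
      · rw [div_le_iff₀ hN0]; exact Nat.floor_le hFN
      · have h2 : F E - 1 / N ≤ (⌊F E * N⌋₊ : ℝ) / N := by
          rw [le_div_iff₀ hN0, sub_mul, one_div_mul_cancel hN0.ne']
          linarith [Nat.lt_floor_add_one (F E * N)]
        linarith
  refine (measure_mono hcover).trans ((measure_biUnion_finset_le _ _).trans ?_)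
  refine (Finset.sum_le_card_nsmul _ _ (p + p) fun k _ =>
    (measure_union_le _ _).trans (add_le_add (hup _) (hlow _))).trans (le_of_eq ?_)
  rw [Finset.card_range, hp, ← ENNReal.ofReal_add (by positivity) (by positivity),
    ← ENNReal.ofReal_nsmul]
  congr 1
  simp
  ring

end Uniform

/-! ### Independence of the cells -/

section Independence

theorem boxMatrix_congr {ω ω' : (Fin d → ℤ) → ℝ} {Λ : Finset (Fin d → ℤ)}
    (h : ∀ x ∈ Λ, ω x = ω' x) : boxMatrix ω Λ = boxMatrix ω' Λ := by
  ext x y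
  rw [boxMatrix_apply, boxMatrix_apply]
  simp only [formalOp, LinearMap.coe_mk, AddHom.coe_mk, h x.1 x.2]

theorem countingFun_congr {ω ω' : (Fin d → ℤ) → ℝ} {Λ : Finset (Fin d → ℤ)}
    (h : ∀ x ∈ Λ, ω x = ω' x) (E : ℝ) : countingFun ω Λ E = countingFun ω' Λ E := by
  rw [countingFun_eq, countingFun_eq, eigCount_eq_countP, eigCount_eq_countP, boxMatrix_congr h]

/-- The values of the potential in a cell, as a function on the reference cube. -/
def cellPotential {q : ℕ} (a : Fin d → ℤ) (b : ℕ) (ω : (Fin d → ℤ) → ℝ) (j : Fin d → Fin q)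
    (y : (cube 0 b : Finset (Fin d → ℤ))) : ℝ :=
  ω (y.1 + cellCorner a (b + 1) j)

theorem add_cellCorner_injective {q : ℕ} (a : Fin d → ℤ) (b : ℕ) : Function.Injective
    fun p : (Fin d → Fin q) × (cube 0 b : Finset (Fin d → ℤ)) =>
      p.2.1 + cellCorner a (b + 1) p.1 := by
  rintro ⟨j, y⟩ ⟨k, z⟩ h
  have hmem : ∀ (j : Fin d → Fin q) (y : (cube 0 b : Finset (Fin d → ℤ))),
      y.1 + cellCorner a (b + 1) j ∈ cube (cellCorner a (b + 1) j) b := by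
    intro j y
    rw [cube_eq_map (cellCorner a (b + 1) j)]
    exact Finset.mem_map.2 ⟨y.1, y.2, rfl⟩
  have hjk : j = k := by
    by_contra hne
    exact (separated_cells a b hne _ (hmem j y) _ (hmem k z)).1 h
  subst hjk
  have : y.1 = z.1 := add_right_cancel h
  rw [Subtype.ext this]

/-- Cells are disjoint, so pairs (cell, site) embed into the lattice and their joint law is a
product; currying groups it by cells. -/
theorem iIndepFun_cellPotential (μ : ProbabilityMeasure ℝ) (a : Fin d → ℤ) (b q : ℕ) :
    ProbabilityTheory.iIndepFun
      (fun (j : Fin d → Fin q) ω => cellPotential a b ω j) (law d μ) := by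
  have hm : ∀ j : Fin d → Fin q, Measurable fun ω => cellPotential a b ω j := fun j => by
    unfold cellPotential; fun_prop
  rw [ProbabilityTheory.iIndepFun_iff_map_fun_eq_infinitePi_map hm]
  have h1 : ∀ j : Fin d → Fin q, (law d μ).map (fun ω => cellPotential a b ω j) =
      Measure.infinitePi fun _ => (μ : Measure ℝ) := fun j =>
    Measure.map_infinitePi_infinitePi_of_inj (P := fun _ : Fin d → ℤ => (μ : Measure ℝ))
      (f := fun y : (cube 0 b : Finset (Fin d → ℤ)) => y.1 + cellCorner a (b + 1) j)
      fun y z h => Subtype.ext (add_right_cancel h)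
  have h2 := Measure.map_infinitePi_infinitePi_of_inj (P := fun _ : Fin d → ℤ => (μ : Measure ℝ))
    (add_cellCorner_injective (q := q) a b)
  have h3 := Measure.infinitePi_map_curry
    fun (_ : Fin d → Fin q) (_ : (cube 0 b : Finset (Fin d → ℤ))) => (μ : Measure ℝ)
  simp only [h1]
  rw [← h3, ← h2, Measure.map_map (by fun_prop) (by fun_prop)]
  rfl

theorem iIndepFun_countingFun_cells (μ : ProbabilityMeasure ℝ) (a : Fin d → ℤ) (b q : ℕ)
    (E : ℝ) : ProbabilityTheory.iIndepFun (fun (j : Fin d → Fin q) ω =>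
      countingFun ω (cube (cellCorner a (b + 1) j) b) E) (law d μ) := by
  classical
  -- The values put outside the reference cube are irrelevant, since the box matrix sees the
  -- potential only inside.
  let ext : ((cube 0 b : Finset (Fin d → ℤ)) → ℝ) → (Fin d → ℤ) → ℝ :=
    fun η z => if h : z ∈ cube 0 b then η ⟨z, h⟩ else 0
  have hext : Measurable ext := by
    refine measurable_pi_lambda _ fun z => ?_
    by_cases h : z ∈ cube 0 b
    · simp only [ext, h, dif_pos]; fun_prop
    · simp only [ext, h, dif_neg, not_false_eq_true]; fun_prop
  have h := (iIndepFun_cellPotential μ a b q).comp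
    (fun _ η => countingFun (ext η) (cube 0 b) E)
    fun _ => (measurable_countingFun (cube 0 b) E).comp hext
  convert h using 2 with j
  funext ω
  rw [countingFun_cube]
  refine countingFun_congr (fun x hx => ?_) E
  simp [ext, hx, cellPotential]

theorem measure_cellAverage_deviation_le (μ : ProbabilityMeasure ℝ) (a : Fin d → ℤ) (b : ℕ)
    {q : ℕ} (hq : 0 < q) {N : ℕ} (hN : 0 < N) {t : ℝ} (ht : 0 ≤ t) :
    law d μ {ω | ∃ E, 1 / N + t < |cellAverage ω a b q E - meanCount d μ b E|} ≤
      ENNReal.ofReal (2 * (N + 1) * Real.exp (-2 * (q : ℝ) ^ d * t ^ 2)) := by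
  have : Nonempty (Fin d → Fin q) := ⟨fun _ => ⟨0, hq⟩⟩
  have h := measure_exists_deviation_le (P := law d μ)
    (X := fun (j : Fin d → Fin q) E ω => countingFun ω (cube (cellCorner a (b + 1) j) b) E)
    (fun j E => measurable_countingFun _ E)
    (fun j E ω => ⟨countingFun_nonneg _ _ _, countingFun_le_one _ _ _⟩)
    (fun j ω => countingFun_mono ω _) (fun E => iIndepFun_countingFun_cells μ a b q E)
    (F := meanCount d μ b) (fun j E => integral_countingFun_cube μ _ b E) hN ht
  simpa [cellAverage] using h

end Independence

/-! ### Numerical estimates -/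

section Numerics

theorem log_three_halves_gt : 0.40546 < Real.log (3 / 2) := by
  -- At `1 / 5` the quotient `(1 + x) / (1 - x)` is `3 / 2`; three terms of the series suffice.
  have h := Real.hasSum_log_sub_log_of_abs_lt_one (x := 1 / 5) (by norm_num [abs_lt])
  have h1 : Real.log (1 + 1 / 5) - Real.log (1 - 1 / 5) = Real.log (3 / 2) := by
    rw [← Real.log_div (by norm_num) (by norm_num)]
    norm_num
  rw [h1] at h
  have h2 := sum_le_hasSum (Finset.range 3) (fun k _ => by positivity) h
  norm_num [Finset.sum_range_succ] at h2 ⊢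
  linarith

theorem constant_lt : 480 / Real.log (3 / 2) + 16 / Real.log 2 < 1207 := by
  have h1 := log_three_halves_gt
  have h2 := Real.log_two_gt_d9
  have e1 : 480 / Real.log (3 / 2) ≤ 480 / 0.40546 := by gcongr
  have e2 : 16 / Real.log 2 ≤ 16 / 0.6931471803 := by gcongr
  norm_num at e1 e2 ⊢
  linarith

theorem one_le_constant : 1 ≤ 480 / Real.log (3 / 2) + 16 / Real.log 2 := by
  have h1 : 0 < Real.log (3 / 2) := Real.log_pos (by norm_num)
  have h2 : 0 < Real.log 2 := Real.log_pos (by norm_num)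
  have h3 := Real.log_two_lt_d9
  have e2 : 1 ≤ 16 / Real.log 2 := by
    rw [one_le_div h2]; norm_num at h3 ⊢; linarith
  have : 0 < 480 / Real.log (3 / 2) := by positivity
  linarith

/-- For `x ≥ 4` one has `x - 1 ≤ (x - 2) ^ 2`, which absorbs the `2` in the exponent `2 / (d - 2)`.
-/
theorem lt_pow_of_rpow_lt {d : ℕ} (hd : 3 ≤ d) {y x : ℝ} (hy : 0 ≤ y) (hx : 4 ≤ x)
    (h : y ^ (2 / ((d : ℝ) - 2)) + 1 < x) : y < (x - 2) ^ (d - 2) := by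
  have hd' : (3 : ℝ) ≤ d := by exact_mod_cast hd
  have hd2 : (0 : ℝ) < (d : ℝ) - 2 := by linarith
  have h1 : y ^ (2 / ((d : ℝ) - 2)) < (x - 2) ^ 2 := by nlinarith
  have h2 := Real.rpow_lt_rpow (by positivity) h1 (show 0 < ((d : ℝ) - 2) / 2 by positivity)
  rw [← Real.rpow_mul hy, div_mul_div_cancel₀ hd2.ne', div_self two_ne_zero, Real.rpow_one,
    ← Real.rpow_natCast (x - 2) 2, ← Real.rpow_mul (by linarith)] at h2
  have h3 : ((2 : ℕ) : ℝ) * (((d : ℝ) - 2) / 2) = ((d - 2 : ℕ) : ℝ) := by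
    rw [Nat.cast_sub (by omega)]; push_cast; ring
  rwa [h3, Real.rpow_natCast] at h2

/-- With `Y = (x - 2) ^ (d - 2)`, the exponent is at most `-2 * Y`. One `Y` is spent on the
prefactor, for which `2 * (N + 1) ≤ Y + 1 ≤ exp Y` because `d ≥ 3` gives `x - 2 ≤ Y`. -/
theorem deviation_prob_le {d : ℕ} (hd : 3 ≤ d) {x q N : ℝ} (hx : 100 ≤ x) (hq : x - 2 ≤ q)
    (hN : N ≤ (x - 1) / 10 + 1) :
    2 * (N + 1) * Real.exp (-2 * q ^ d * (10 / (x - 1)) ^ 2) ≤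
      Real.exp (-(x - 2) ^ (d - 2)) := by
  set Y := (x - 2) ^ (d - 2) with hY
  have hxY : x - 2 ≤ Y := by
    have := pow_le_pow_right₀ (show 1 ≤ x - 2 by linarith) (show 1 ≤ d - 2 by omega)
    simpa using this
  have hq1 : Y * (x - 2) ^ 2 ≤ q ^ d := by
    rw [hY, ← pow_add, Nat.sub_add_cancel (by omega)]
    have : 0 ≤ x - 2 := by linarith
    gcongr
  have h1 : (1 : ℝ) ≤ (x - 2) ^ 2 * (10 / (x - 1)) ^ 2 := by
    rw [div_pow, mul_div_assoc', le_div_iff₀ (by nlinarith)]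
    nlinarith
  have h2 : Y ≤ q ^ d * (10 / (x - 1)) ^ 2 := by
    calc Y = Y * 1 := (mul_one _).symm
      _ ≤ Y * ((x - 2) ^ 2 * (10 / (x - 1)) ^ 2) := by gcongr; linarith
      _ = Y * (x - 2) ^ 2 * (10 / (x - 1)) ^ 2 := by ring
      _ ≤ _ := by gcongr
  have h3 : 2 * (N + 1) ≤ Real.exp Y := by
    have := Real.add_one_le_exp Y
    linarith
  calc 2 * (N + 1) * Real.exp (-2 * q ^ d * (10 / (x - 1)) ^ 2)
      ≤ Real.exp Y * Real.exp (-2 * Y) := by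
        refine mul_le_mul h3 (Real.exp_le_exp.2 ?_) (Real.exp_pos _).le (Real.exp_pos _).le
        linarith
    _ = Real.exp (-Y) := by rw [← Real.exp_add]; ring_nf

end Numerics

/-! ### Choice of the scale and conclusion -/

theorem ofReal_lt_supNorm_iff {β : ℝ} (hβ : 0 ≤ β) {f : ℝ → ℝ} :
    ENNReal.ofReal β < supNorm f ↔ ∃ E, β < |f E| := by
  rw [supNorm, lt_iSup_iff]
  refine exists_congr fun E => ?_
  rw [Real.enorm_eq_ofReal_abs, ENNReal.ofReal_lt_ofReal_iff_of_nonneg hβ]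

/-- The deviation bound for a fixed distribution of the potential. -/
theorem law_deviation_le {d : ℕ} (hd : 3 ≤ d) {β x : ℝ} (hβ : 0 ≤ β) (hx : 100 ≤ x)
    (hβx : (3 * d + 20) / (x - 1) ≤ β) {μ : ProbabilityMeasure ℝ}
    (hμ : Bornology.IsBounded (μ : Measure ℝ).support) :
    law d μ {ω | ENNReal.ofReal β <
      supNorm fun E => countingFun ω (box d (x ^ 2)) E - ids d μ E} ≤
      ENNReal.ofReal (Real.exp (-(x - 2) ^ (d - 2))) := by
  obtain ⟨R, hR⟩ := exists_ae_law_abs_le (d := d) hμ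
  obtain ⟨ℓ, hbox, hℓ1, -⟩ := box_eq_cube d (L := x ^ 2) (by positivity)
  -- The period `b + 1 = ⌈x⌉` is about the square root of the side, which balances the edge and gap
  -- errors `(b + 1) / ℓ` and `1 / (b + 1)`.
  obtain ⟨b, hb⟩ : ∃ b, ⌈x⌉₊ = b + 1 :=
    Nat.exists_eq_succ_of_ne_zero (Nat.ceil_pos.2 (by linarith)).ne'
  have hxb : x ≤ (b : ℝ) + 1 := by
    have := Nat.le_ceil x
    rw [hb] at this
    exact_mod_cast this
  have hbx : (b : ℝ) + 1 < x + 1 := by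
    have := Nat.ceil_lt_add_one (show 0 ≤ x by linarith)
    rw [hb] at this
    exact_mod_cast this
  have hx1 : 0 < x - 1 := by linarith
  -- Since `ℓ > x ^ 2 - 1 = (x - 1) * (x + 1)` and `b + 1 < x + 1`.
  have hnℓ : (x - 1) * ((b : ℝ) + 1) ≤ ℓ := by nlinarith
  have hb0 : 0 < b := by
    have : (0 : ℝ) < b := by linarith
    exact_mod_cast this
  have hbℓ : b + 1 ≤ ℓ := by
    have : (b : ℝ) + 1 ≤ ℓ := by nlinarith
    exact_mod_cast this
  have hℓ0 : (0 : ℝ) < ℓ := by nlinarith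
  set q := ℓ / (b + 1) with hqdef
  have hq0 : 0 < q := Nat.div_pos hbℓ (by omega)
  have hq : x - 2 ≤ q := by
    have h1 : ℓ < (b + 1) * q + (b + 1) := by
      have h1 := Nat.div_add_mod ℓ (b + 1)
      have h2 := Nat.mod_lt ℓ (show 0 < b + 1 by omega)
      rw [← hqdef] at h1
      omega
    have h2 : (ℓ : ℝ) < (b + 1) * q + (b + 1) := by exact_mod_cast h1
    have h3 : ((b : ℝ) + 1) * (x - 1) < (b + 1) * (q + 1) := by linarith
    have := lt_of_mul_lt_mul_left h3 (by positivity)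
    linarith
  have hN0 : 0 < ⌈(x - 1) / 10⌉₊ := Nat.ceil_pos.2 (by positivity)
  have hN1 := Nat.le_ceil ((x - 1) / 10)
  have hN2 := (Nat.ceil_lt_add_one (show 0 ≤ (x - 1) / 10 by positivity)).le
  set N := ⌈(x - 1) / 10⌉₊ with hNdef
  have hprob := measure_cellAverage_deviation_le μ (fun _ => ⌈-(x ^ 2 / 2)⌉) b hq0 hN0
    (t := 10 / (x - 1)) (by positivity) (d := d)
  refine (measure_mono ?_).trans (hprob.trans (ENNReal.ofReal_le_ofReal
    (deviation_prob_le hd hx hq hN2)))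
  intro ω hω
  obtain ⟨E, hE⟩ := (ofReal_lt_supNorm_iff hβ).1 hω
  refine ⟨E, ?_⟩
  rw [hbox] at hE
  have h1 := abs_countingFun_sub_cellAverage_le ω (fun _ : Fin d => ⌈-(x ^ 2 / 2)⌉) hb0 hbℓ E
  rw [← hqdef] at h1
  have h2 := abs_ids_sub_meanCount_le hR hb0 E
  have e1 : ((b : ℝ) + 1) / ℓ ≤ 1 / (x - 1) := by
    rw [div_le_div_iff₀ hℓ0 hx1]; linarith
  have e2 : 1 / ((b : ℝ) + 1) ≤ 1 / (x - 1) := by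
    gcongr; linarith
  have e3 : 1 / (N : ℝ) ≤ 10 / (x - 1) := by
    rw [div_le_div_iff₀ (by exact_mod_cast hN0) hx1]; linarith
  have hd0 : (0 : ℝ) ≤ d := by positivity
  have h1' : d * (((b : ℝ) + 1) / ℓ + 1 / ((b : ℝ) + 1)) ≤ d * (1 / (x - 1) + 1 / (x - 1)) := by
    gcongr
  have h2' : d / ((b : ℝ) + 1) ≤ d * (1 / (x - 1)) := by
    rw [div_eq_mul_one_div]; gcongr
  -- The error budget: two shares of `d / (x - 1)` for tiling, one for the mean, and `10 / (x - 1)`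
  -- each for `1 / N` and `t`.
  have e4 : (3 * d + 20) / (x - 1) = 3 * (d * (1 / (x - 1))) + 2 * (10 / (x - 1)) := by
    field_simp; ring
  set A := countingFun ω (cube (fun _ => ⌈-(x ^ 2 / 2)⌉) ℓ) E
  set B := cellAverage ω (fun _ => ⌈-(x ^ 2 / 2)⌉) b q E
  have tri : |A - ids d μ E| ≤ |A - B| + |B - meanCount d μ b E| +
      |ids d μ E - meanCount d μ b E| := by
    have t1 := abs_sub_le A B (ids d μ E)
    have t2 := abs_sub_le B (meanCount d μ b E) (ids d μ E)
    rw [abs_sub_comm (meanCount d μ b E)] at t2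
    linarith
  linarith

end Anderson

theorem mainTheorem2 (d : ℕ) (hd : 3 ≤ d) (α β : ℝ) (hα : α ∈ Set.Ioo (0 : ℝ) 1)
    (hβ : β ∈ Set.Ioo (0 : ℝ) 1) (C K : ℝ)
    (hC : C = 40 * (d : ℝ) + 104 * 2 ^ d - 51)
    (hK : K = 480 / Real.log (3 / 2) + 16 / Real.log 2)
    (L : ℝ)
    (hL : max (max ((C / β + 1) ^ 2)
      (((Real.log (2 / α) * K) ^ (2 / ((d : ℝ) - 2)) + 1) ^ 2)) 16 < L) :
    K < 1207 ∧
    (⨆ (μ : ProbabilityMeasure ℝ) (_ : Bornology.IsBounded (μ : Measure ℝ).support),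
      Anderson.law d μ {ω | ENNReal.ofReal β < Anderson.supNorm (fun E =>
        Anderson.countingFun ω (Anderson.box d L) E - Anderson.ids d μ E)}) < ENNReal.ofReal α ∧
    ∀ μ : ProbabilityMeasure ℝ, Bornology.IsBounded (μ : Measure ℝ).support →
      ENNReal.ofReal (1 - α) <
        Anderson.law d μ {ω | Anderson.ids d μ ∈ Anderson.confidenceRegion d L β ω} := by
  obtain ⟨hα0, hα1⟩ := hα
  obtain ⟨hβ0, hβ1⟩ := hβ
  have hd' : (3 : ℝ) ≤ d := by exact_mod_cast hd
  have hC' : 40 * (d : ℝ) + 781 ≤ C := by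
    have : (2 : ℝ) ^ 3 ≤ 2 ^ d := pow_le_pow_right₀ one_le_two hd
    rw [hC]; linarith
  have hK1 : 1 ≤ K := hK ▸ Anderson.one_le_constant
  have hlog : 0 < Real.log (2 / α) := Real.log_pos (by rw [lt_div_iff₀ hα0]; linarith)
  simp only [max_lt_iff] at hL
  obtain ⟨⟨hL1, hL2⟩, hL3⟩ := hL
  have hy : 0 ≤ Real.log (2 / α) * K := by positivity
  have hCβ : 0 < C / β := div_pos (by linarith) hβ0
  obtain ⟨x, hx0, rfl⟩ : ∃ x, 0 ≤ x ∧ L = x ^ 2 :=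
    ⟨√L, Real.sqrt_nonneg L, (Real.sq_sqrt (by linarith)).symm⟩
  have hx1 : C / β + 1 < x := lt_of_pow_lt_pow_left₀ 2 hx0 hL1
  have hx2 := lt_of_pow_lt_pow_left₀ 2 hx0 hL2
  have hCC : C ≤ C / β := by
    rw [le_div_iff₀ hβ0]; nlinarith
  have hx : 100 ≤ x := by linarith
  have hβx : (3 * (d : ℝ) + 20) / (x - 1) ≤ β := by
    rw [div_le_iff₀ (by linarith)]
    have h1 : C / β < x - 1 := by linarith
    rw [div_lt_iff₀ hβ0] at h1
    linarith
  have hY := Anderson.lt_pow_of_rpow_lt hd hy (by linarith) hx2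
  -- Already `K ≥ 1` gives the bound `α / 2`. It does not depend on `μ`, so the supremum stays
  -- strictly below `α`.
  have hexp : Real.exp (-(x - 2) ^ (d - 2)) < α := by
    have h1 : Real.log (2 / α) < (x - 2) ^ (d - 2) :=
      lt_of_le_of_lt (le_mul_of_one_le_right hlog.le hK1) hY
    have h2 : Real.exp (-(x - 2) ^ (d - 2)) < Real.exp (-Real.log (2 / α)) :=
      Real.exp_lt_exp.2 (neg_lt_neg h1)
    rw [Real.exp_neg (Real.log (2 / α)), Real.exp_log (by positivity), inv_div] at h2
    linarith
  have hbad := fun (μ : ProbabilityMeasure ℝ) hμ =>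
    Anderson.law_deviation_le (μ := μ) hd hβ0.le hx hβx hμ
  refine ⟨hK ▸ Anderson.constant_lt, ?_, fun μ hμ => ?_⟩
  · exact (iSup₂_le hbad).trans_lt ((ENNReal.ofReal_lt_ofReal_iff hα0).2 hexp)
  · obtain ⟨R, hR⟩ := Anderson.exists_ae_law_abs_le (d := d) hμ
    -- The measurability of these two events is not established, so the complement is handled by
    -- covering the whole space and subadditivity.
    have hcover : (Set.univ : Set ((Fin d → ℤ) → ℝ)) ⊆
        {ω | Anderson.ids d μ ∈ Anderson.confidenceRegion d (x ^ 2) β ω} ∪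
        {ω | ENNReal.ofReal β < Anderson.supNorm (fun E =>
          Anderson.countingFun ω (Anderson.box d (x ^ 2)) E - Anderson.ids d μ E)} := by
      intro ω _
      by_cases h : ENNReal.ofReal β < Anderson.supNorm (fun E =>
          Anderson.countingFun ω (Anderson.box d (x ^ 2)) E - Anderson.ids d μ E)
      · exact Or.inr h
      · refine Or.inl ⟨⟨1, fun E => ?_⟩, Anderson.continuousWithinAt_ids hR,
          Anderson.ids_mono hR, not_lt.1 h⟩
        obtain ⟨h0, h1⟩ := Anderson.ids_mem_Icc hR E
        rwa [abs_of_nonneg h0]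
    have h1 : (1 : ℝ≥0∞) ≤ Anderson.law d μ
        {ω | Anderson.ids d μ ∈ Anderson.confidenceRegion d (x ^ 2) β ω} +
        ENNReal.ofReal (Real.exp (-(x - 2) ^ (d - 2))) := by
      rw [← measure_univ (μ := Anderson.law d μ)]
      exact (measure_mono hcover).trans ((measure_union_le _ _).trans
        (add_le_add_right (hbad μ hμ) _))
    have h2 : ENNReal.ofReal (1 - Real.exp (-(x - 2) ^ (d - 2))) ≤ Anderson.law d μ
        {ω | Anderson.ids d μ ∈ Anderson.confidenceRegion d (x ^ 2) β ω} := by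
      rw [ENNReal.ofReal_sub _ (Real.exp_pos _).le, ENNReal.ofReal_one]
      exact tsub_le_iff_right.2 h1
    refine lt_of_lt_of_le ?_ h2
    exact (ENNReal.ofReal_lt_ofReal_iff (by linarith)).2 (by linarith)
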